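/- Let $G\subset\mathbb R^3$ be open and bounded with $C^\infty$ boundary ($\overline G$ is a $C^\infty$ submanifold with boundary) and strictly convex closure, let $\nu$ be the outward unit normal on $\partial G$, $S\subset\mathbb R^3$ the unit sphere with surface measure $d\omega$, $I=[E_0,E_m]$ with $0\le E_0<E_m<\infty$, and $$\Gamma_-=\{(y,\omega,E)\in\partial G\times S\times I:\omega\cdot\nu(y)<0\},\qquad \Gamma_0=\{(y,\omega,E)\in\partial G\times S\times I:\omega\cdot\nu(y)=0\}.$$ All functions are real valued and $L^p(G\times S\times I)$ is taken with respect to $dx\,d\omega\,dE$. For $k\in\mathbb N_0\cup\{\infty\}$ let $C^{(k,0,0)}(\overline G\times S\times I)$ be the set of restrictions to $G\times S\times I^\circ$ of compactly supported functions $f$ on $\mathbb R^3\times S\times\mathbb R$ all of whose partial derivatives $\partial_x^\alpha f$, $|\alpha|\le k$, exist and are continuous on $\mathbb R^3\times S\times\mathbb R$, and let $$\mathcal D:=\bigcap_{k=1}^\infty\{\psi\in C^{(k,0,0)}(\overline G\times S\times I):\operatorname{supp}\psi\cap(\Gamma_-\cup\Gamma_0)=\emptyset\}.$$ Let $m\in\mathbb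 N_0$. Let $H_0^m:=H_0^{(m,0,0)}(G\times S\times I,\Gamma_-)$ be the completion of $\mathcal D$ with respect to the inner product $\langle\psi,v\rangle=\sum_{|\alpha|\le m}\langle\partial_x^\alpha\psi,\partial_x^\alpha v\rangle_{L^2(G\times S\times I)}$, and let $\mathcal W^m:=\mathcal W^{\infty,(m,0,0)}(G\times S\times I)$ be the completion of $C^{(\infty,0,0)}(\overline G\times S\times I)$ with respect to the norm $\|\phi\|_{W^{\infty,(m,0,0)}}=\max_{|\alpha|\le m}\|\partial_x^\alpha\phi\|_{L^\infty(G\times S\times I)}$. There is a constant $c(m)>0$ depending only on $m$ (not on $G$, $I$) such that $$\|\Sigma\psi\|_{H_0^m}\le c(m)\,\|\Sigma\|_{W^{\infty,(m,0,0)}}\,\|\psi\|_{H_0^m}\qquad\text{for all }\Sigma\in\mathcal W^m,\ \psi\in\mathcal D,\tag{1}$$ where, for $\Sigma\in\mathcal W^m$ and $\psi\in\mathcal D$, the product $\Sigma\psi$ belongs to $H_0^m$. Let $\Sigma\in\mathcal W^m$. The operator $P_m$ in $H_0^m$ with domain $D(P_m)=\mathcal D$ and $P_m\psi=\omega\cdot\nabla_x\psi+\Sigma\psi$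 is well defined (it takes values in $H_0^m$) and closable; let $\widetilde P_m$ be its closure (smallest closed extension). Let $c(m)>0$ be any constant for which (1) holds, and put $C':=c(m)\|\Sigma\|_{W^{\infty,(m,0,0)}}$. Then for every $C\ge C'$ $$\langle(\widetilde P_m+C\,\mathrm{Id})\psi,\psi\rangle_{H_0^m}\ \ge\ (C-C')\,\|\psi\|_{H_0^m}^2\qquad\text{for all }\psi\in D(\widetilde P_m).$$ In particular, for every $C\ge C'$ the operator $\widetilde P_m+C\,\mathrm{Id}$ is accretive in $H_0^m$, i.e. $\langle(\widetilde P_m+C\,\mathrm{Id})\psi,\psi\rangle_{H_0^m}\ge0$ for all $\psi\in D(\widetilde P_m)$. -/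

import Mathlib

open MeasureTheory Set
open scoped ENNReal ContDiff

namespace Transport

/-- Three-dimensional Euclidean space. -/
abbrev E3 : Type := EuclideanSpace ℝ (Fin 3)

/-- The unit sphere `S` of `ℝ³`. -/
abbrev S2 : Type := Metric.sphere (0 : E3) 1

/-- The ambient space `ℝ³ × S × ℝ` of points `(x, ω, E)`. -/
abbrev Pt : Type := E3 × S2 × ℝ

/-- Multi-indices `α ∈ ℕ₀³` with `|α| ≤ m`. -/
abbrev MultiIndex (m : ℕ) : Type := {α : Fin 3 → Fin (m + 1) // ∑ i, (α i : ℕ) ≤ m}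

/-- The underlying element of `ℕ₀³`. -/
def MultiIndex.exps {m : ℕ} (α : MultiIndex m) : Fin 3 → ℕ := fun i => (α.1 i : ℕ)

/-- The multi-index `(0, 0, 0)`. -/
def MultiIndex.zero (m : ℕ) : MultiIndex m := ⟨fun _ => 0, by simp⟩

/-- The list of directions `e₀, …, e₀, e₁, …, e₁, e₂, …, e₂`, where `eᵢ` occurs `aᵢ` times. -/
noncomputable def multiDir (a : Fin 3 → ℕ) (j : Fin (∑ i, a i)) : E3 :=
  EuclideanSpace.single
    (if (j : ℕ) < a 0 then (0 : Fin 3) else if (j : ℕ) < a 0 + a 1 then 1 else 2) (1 : ℝ)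

/-- The partial derivative `∂ₓ^a f` at the point `(x, ω, E)`, taken in the variable `x` only. -/
noncomputable def spatialDeriv (a : Fin 3 → ℕ) (f : Pt → ℝ) (p : Pt) : ℝ :=
  iteratedFDeriv ℝ (∑ i, a i) (fun x => f (x, p.2)) p.1 (multiDir a)

/-- The streaming term `ω · ∇ₓ f` at the point `(x, ω, E)`. -/
noncomputable def streaming (f : Pt → ℝ) (p : Pt) : ℝ :=
  fderiv ℝ (fun x => f (x, p.2)) p.1 (p.2.1 : E3)

/-- The space `C₀^{(k,0,0)}(ℝ³ × S × ℝ)`, `k ∈ ℕ₀ ∪ {∞}`: compactly supported functions all of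
whose partial derivatives in `x` up to order `k` exist and are jointly continuous in
`(x, ω, E)`. -/
structure IsCk0 (k : ℕ∞) (f : Pt → ℝ) : Prop where
  contDiff : ∀ q : S2 × ℝ, ContDiff ℝ (k : WithTop ℕ∞) (fun x => f (x, q))
  continuous : ∀ a : Fin 3 → ℕ, ((∑ i, a i : ℕ) : ℕ∞) ≤ k → Continuous (spatialDeriv a f)
  hasCompactSupport : HasCompactSupport f

/-- `φ` is a smooth function, defined near `y`, without critical points, and such that near `y`
the set `G` is `{φ < 0}`.  (For a boundary point `y` of an open set `G` this means that near `y`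
the closure of `G` is the smooth manifold with boundary `{φ ≤ 0}`, with interior `G`.) -/
def IsDefiningFunction (G : Set E3) (y : E3) (φ : E3 → ℝ) : Prop :=
  ∃ U : Set E3, IsOpen U ∧ y ∈ U ∧ ContDiffOn ℝ ∞ φ U ∧
    (∀ x ∈ U, gradient φ x ≠ 0) ∧ ∀ x ∈ U, (x ∈ G ↔ φ x < 0)

/-- `n` is the outward pointing unit normal of `∂G` at `y`. -/
def IsOutwardUnitNormal (G : Set E3) (y n : E3) : Prop :=
  ∃ φ : E3 → ℝ, IsDefiningFunction G y φ ∧ n = ‖gradient φ y‖⁻¹ • gradient φ y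

/-- The standing geometric data: an open bounded set `G ⊆ ℝ³` with smooth boundary and strictly
convex closure, and an energy interval `I = [E₀, E₁]` with `0 ≤ E₀ < E₁ < ∞`. -/
structure Domain where
  G : Set E3
  E₀ : ℝ
  E₁ : ℝ
  isOpen : IsOpen G
  isBounded : Bornology.IsBounded G
  smooth_boundary : ∀ y ∈ frontier G, ∃ φ : E3 → ℝ, IsDefiningFunction G y φ
  strictConvex_closure : StrictConvex ℝ (closure G)
  E₀_nonneg : 0 ≤ E₀
  E₀_lt_E₁ : E₀ < E₁

namespace Domain

variable (D : Domain)

/-- The set `G × S × I°`. -/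
def Ω : Set Pt := D.G ×ˢ ((univ : Set S2) ×ˢ Ioo D.E₀ D.E₁)

/-- The measure `dx dω dE` on `G × S × I`, `dω` being the surface measure of the unit sphere
(the end points of `I` form a null set). -/
noncomputable def μ : Measure Pt :=
  ((volume : Measure E3).prod
    (((volume : Measure E3).toSphere).prod (volume : Measure ℝ))).restrict D.Ω

/-- The inflow boundary `Γ₋`. -/
def Γminus : Set Pt :=
  {p | p.1 ∈ frontier D.G ∧ p.2.2 ∈ Icc D.E₀ D.E₁ ∧
    ∃ n, IsOutwardUnitNormal D.G p.1 n ∧ inner ℝ (p.2.1 : E3) n < 0}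

/-- The characteristic boundary `Γ₀`. -/
def Γzero : Set Pt :=
  {p | p.1 ∈ frontier D.G ∧ p.2.2 ∈ Icc D.E₀ D.E₁ ∧
    ∃ n, IsOutwardUnitNormal D.G p.1 n ∧ inner ℝ (p.2.1 : E3) n = 0}

/-- The space `C^{(k,0,0)}(Ḡ × S × I)` of restrictions to `G × S × I°` of elements of
`C₀^{(k,0,0)}(ℝ³ × S × ℝ)`.  A function on `G × S × I°` is represented by any function on the
ambient space that agrees with it there. -/
def IsCkBar (k : ℕ∞) (ψ : Pt → ℝ) : Prop :=
  ∃ f : Pt → ℝ, IsCk0 k f ∧ EqOn ψ f D.Ω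

/-- The support of a function on `G × S × I°`, as a closed subset of `Ḡ × S × I`. -/
def supp (ψ : Pt → ℝ) : Set Pt := closure (D.Ω ∩ Function.support ψ)

/-- The space `C₀^{(k,0,0)}(Ḡ × S × I, Γ₋)`. -/
def IsCk0Inflow (k : ℕ∞) (ψ : Pt → ℝ) : Prop :=
  D.IsCkBar k ψ ∧ D.supp ψ ∩ (D.Γminus ∪ D.Γzero) = ∅

end Domain

/-! ### Elementary facts needed to define the function spaces -/

theorem IsCk0.zero (k : ℕ∞) : IsCk0 k (0 : Pt → ℝ) where
  contDiff q := contDiff_const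
  continuous a _ := by
    have : spatialDeriv a (0 : Pt → ℝ) = 0 := by
      funext p
      simp only [spatialDeriv, Pi.zero_apply]
      have := iteratedFDeriv_fun_zero (𝕜 := ℝ) (E := E3) (F := ℝ) (n := ∑ i, a i)
      simp [this]
    rw [this]
    exact continuous_const
  hasCompactSupport := HasCompactSupport.zero

theorem IsCk0.spatialDeriv_add {k : ℕ∞} {f g : Pt → ℝ} (hf : IsCk0 k f) (hg : IsCk0 k g)
    {a : Fin 3 → ℕ} (ha : ((∑ i, a i : ℕ) : ℕ∞) ≤ k) :
    spatialDeriv a (f + g) = spatialDeriv a f + spatialDeriv a g := by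
  funext p
  have h : ((∑ i, a i : ℕ) : WithTop ℕ∞) ≤ (k : WithTop ℕ∞) := by exact_mod_cast ha
  have := iteratedFDeriv_add_apply (x := p.1) ((hf.contDiff p.2).of_le h).contDiffAt
    ((hg.contDiff p.2).of_le h).contDiffAt
  have h2 := congrArg (fun M => M (multiDir a)) this
  exact h2

theorem IsCk0.spatialDeriv_smul {k : ℕ∞} {f : Pt → ℝ} (hf : IsCk0 k f) (c : ℝ)
    {a : Fin 3 → ℕ} (ha : ((∑ i, a i : ℕ) : ℕ∞) ≤ k) :
    spatialDeriv a (c • f) = c • spatialDeriv a f := by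
  funext p
  have h : ((∑ i, a i : ℕ) : WithTop ℕ∞) ≤ (k : WithTop ℕ∞) := by exact_mod_cast ha
  have := iteratedFDeriv_const_smul_apply (x := p.1) (a := c)
    ((hf.contDiff p.2).of_le h).contDiffAt
  have h2 := congrArg (fun M => M (multiDir a)) this
  exact h2

theorem IsCk0.add {k : ℕ∞} {f g : Pt → ℝ} (hf : IsCk0 k f) (hg : IsCk0 k g) :
    IsCk0 k (f + g) where
  contDiff q := (hf.contDiff q).add (hg.contDiff q)
  continuous a ha := by
    rw [hf.spatialDeriv_add hg ha]
    exact (hf.continuous a ha).add (hg.continuous a ha)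
  hasCompactSupport := hf.hasCompactSupport.add hg.hasCompactSupport

theorem IsCk0.smul {k : ℕ∞} {f : Pt → ℝ} (hf : IsCk0 k f) (c : ℝ) : IsCk0 k (c • f) where
  contDiff q := contDiff_const.smul (hf.contDiff q)
  continuous a ha := by
    rw [hf.spatialDeriv_smul c ha]
    exact (hf.continuous a ha).const_smul c
  hasCompactSupport := hf.hasCompactSupport.mono (Function.support_const_smul_subset c f)

theorem IsCk0.hasCompactSupport_spatialDeriv {k : ℕ∞} {f : Pt → ℝ} (hf : IsCk0 k f)
    (a : Fin 3 → ℕ) : HasCompactSupport (spatialDeriv a f) := by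
  refine hf.hasCompactSupport.mono' fun p hp => ?_
  by_contra hn
  refine hp ?_
  have h0 : f =ᶠ[nhds p] 0 := notMem_tsupport_iff_eventuallyEq.mp hn
  have hc : Filter.Tendsto (fun x : E3 => ((x, p.2) : Pt)) (nhds p.1) (nhds p) :=
    (Continuous.prodMk_left p.2).tendsto p.1
  have h1 : (fun x : E3 => f (x, p.2)) =ᶠ[nhds p.1] fun _ => 0 := hc.eventually h0
  have h2 := (h1.iteratedFDeriv ℝ (∑ i, a i)).eq_of_nhds
  have h3 := iteratedFDeriv_fun_zero (𝕜 := ℝ) (E := E3) (F := ℝ) (n := ∑ i, a i)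
  simp only [spatialDeriv, h2]
  simp [h3]

theorem toLp_add_of_ae {μ : Measure Pt} {r : ℝ≥0∞} {f g h : Pt → ℝ} (hf : MemLp f r μ)
    (hg : MemLp g r μ) (hh : MemLp h r μ) (e : h =ᵐ[μ] f + g) :
    hh.toLp h = hf.toLp f + hg.toLp g := by
  rw [← MemLp.toLp_add hf hg]
  exact (MemLp.toLp_eq_toLp_iff hh (hf.add hg)).mpr e

theorem toLp_smul_of_ae {μ : Measure Pt} {r : ℝ≥0∞} {f h : Pt → ℝ} (hf : MemLp f r μ)
    (hh : MemLp h r μ) (c : ℝ) (e : h =ᵐ[μ] c • f) : hh.toLp h = c • hf.toLp f := by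
  rw [← MemLp.toLp_const_smul c hf]
  exact (MemLp.toLp_eq_toLp_iff hh (hf.const_smul c)).mpr e

namespace Domain

variable {D : Domain}

theorem mem_nhds_slice {p : Pt} (hp : p ∈ D.Ω) : ∀ᶠ x in nhds p.1, ((x, p.2) : Pt) ∈ D.Ω :=
  Filter.Eventually.mono (D.isOpen.mem_nhds hp.1) fun _ hx => ⟨hx, hp.2⟩

theorem spatialDeriv_congr {f g : Pt → ℝ} (h : EqOn f g D.Ω) (a : Fin 3 → ℕ) :
    EqOn (spatialDeriv a f) (spatialDeriv a g) D.Ω := by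
  intro p hp
  have h1 : (fun x : E3 => f (x, p.2)) =ᶠ[nhds p.1] fun x => g (x, p.2) :=
    (mem_nhds_slice hp).mono fun x hx => h hx
  simp only [spatialDeriv, (h1.iteratedFDeriv ℝ (∑ i, a i)).eq_of_nhds]

theorem streaming_congr {f g : Pt → ℝ} (h : EqOn f g D.Ω) :
    EqOn (streaming f) (streaming g) D.Ω := by
  intro p hp
  have h1 : (fun x : E3 => f (x, p.2)) =ᶠ[nhds p.1] fun x => g (x, p.2) :=
    (mem_nhds_slice hp).mono fun x hx => h hx
  simp only [streaming, h1.fderiv_eq]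

theorem measurableSet_Ω : MeasurableSet D.Ω :=
  D.isOpen.measurableSet.prod (MeasurableSet.univ.prod measurableSet_Ioo)

theorem ae_eq_of_eqOn {f g : Pt → ℝ} (h : EqOn f g D.Ω) : f =ᵐ[D.μ] g :=
  (ae_restrict_mem measurableSet_Ω).mono fun _ hp => h hp

theorem IsCkBar.add {k : ℕ∞} {ψ φ : Pt → ℝ} (h : D.IsCkBar k ψ) (h' : D.IsCkBar k φ) :
    D.IsCkBar k (ψ + φ) := by
  obtain ⟨f, hf, hψ⟩ := h
  obtain ⟨g, hg, hφ⟩ := h'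
  exact ⟨f + g, hf.add hg, fun p hp => by simp [hψ hp, hφ hp]⟩

theorem IsCkBar.smul {k : ℕ∞} {ψ : Pt → ℝ} (h : D.IsCkBar k ψ) (c : ℝ) :
    D.IsCkBar k (c • ψ) := by
  obtain ⟨f, hf, hψ⟩ := h
  exact ⟨c • f, hf.smul c, fun p hp => by simp [hψ hp]⟩

theorem IsCkBar.zero (k : ℕ∞) : D.IsCkBar k 0 := ⟨0, IsCk0.zero k, fun _ _ => rfl⟩

theorem IsCkBar.spatialDeriv_add {k : ℕ∞} {ψ φ : Pt → ℝ} (h : D.IsCkBar k ψ)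
    (h' : D.IsCkBar k φ) {a : Fin 3 → ℕ} (ha : ((∑ i, a i : ℕ) : ℕ∞) ≤ k) :
    spatialDeriv a (ψ + φ) =ᵐ[D.μ] spatialDeriv a ψ + spatialDeriv a φ := by
  obtain ⟨f, hf, hψ⟩ := h
  obtain ⟨g, hg, hφ⟩ := h'
  refine ae_eq_of_eqOn fun p hp => ?_
  have h1 : EqOn (ψ + φ) (f + g) D.Ω := fun p hp => by simp [hψ hp, hφ hp]
  rw [spatialDeriv_congr h1 a hp, hf.spatialDeriv_add hg ha, Pi.add_apply, Pi.add_apply,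
    spatialDeriv_congr hψ a hp, spatialDeriv_congr hφ a hp]

theorem IsCkBar.spatialDeriv_smul {k : ℕ∞} {ψ : Pt → ℝ} (h : D.IsCkBar k ψ) (c : ℝ)
    {a : Fin 3 → ℕ} (ha : ((∑ i, a i : ℕ) : ℕ∞) ≤ k) :
    spatialDeriv a (c • ψ) =ᵐ[D.μ] c • spatialDeriv a ψ := by
  obtain ⟨f, hf, hψ⟩ := h
  refine ae_eq_of_eqOn fun p hp => ?_
  have h1 : EqOn (c • ψ) (c • f) D.Ω := fun p hp => by simp [hψ hp]
  rw [spatialDeriv_congr h1 a hp, hf.spatialDeriv_smul c ha, Pi.smul_apply, Pi.smul_apply,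
    spatialDeriv_congr hψ a hp]

theorem IsCkBar.memLp {k : ℕ∞} {ψ : Pt → ℝ} (h : D.IsCkBar k ψ) (r : ℝ≥0∞)
    {a : Fin 3 → ℕ} (ha : ((∑ i, a i : ℕ) : ℕ∞) ≤ k) : MemLp (spatialDeriv a ψ) r D.μ := by
  obtain ⟨f, hf, hψ⟩ := h
  have h1 := ((hf.continuous a ha).memLp_of_hasCompactSupport (p := r)
    (μ := (volume : Measure E3).prod
      (((volume : Measure E3).toSphere).prod (volume : Measure ℝ)))
    (hf.hasCompactSupport_spatialDeriv a)).restrict D.Ω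
  exact (memLp_congr_ae (ae_eq_of_eqOn (spatialDeriv_congr hψ a))).mpr h1

theorem IsCkBar.streaming_add {k : ℕ∞} (hk : 1 ≤ k) {ψ φ : Pt → ℝ} (h : D.IsCkBar k ψ)
    (h' : D.IsCkBar k φ) : streaming (ψ + φ) =ᵐ[D.μ] streaming ψ + streaming φ := by
  obtain ⟨f, hf, hψ⟩ := h
  obtain ⟨g, hg, hφ⟩ := h'
  refine ae_eq_of_eqOn fun p hp => ?_
  have h1 : EqOn (ψ + φ) (f + g) D.Ω := fun p hp => by simp [hψ hp, hφ hp]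
  have hk' : (k : WithTop ℕ∞) ≠ 0 := by
    have : k ≠ 0 := (zero_lt_one.trans_le hk).ne'
    exact_mod_cast this
  rw [streaming_congr h1 hp, Pi.add_apply, streaming_congr hψ hp, streaming_congr hφ hp]
  have := fderiv_add (((hf.contDiff p.2).differentiable hk') p.1)
    (((hg.contDiff p.2).differentiable hk') p.1)
  exact congrArg (fun M => M (p.2.1 : E3)) this

theorem IsCkBar.streaming_smul {k : ℕ∞} (hk : 1 ≤ k) {ψ : Pt → ℝ} (h : D.IsCkBar k ψ) (c : ℝ) :
    streaming (c • ψ) =ᵐ[D.μ] c • streaming ψ := by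
  obtain ⟨f, hf, hψ⟩ := h
  refine ae_eq_of_eqOn fun p hp => ?_
  have h1 : EqOn (c • ψ) (c • f) D.Ω := fun p hp => by simp [hψ hp]
  have hk' : (k : WithTop ℕ∞) ≠ 0 := by
    have : k ≠ 0 := (zero_lt_one.trans_le hk).ne'
    exact_mod_cast this
  rw [streaming_congr h1 hp, Pi.smul_apply, streaming_congr hψ hp]
  have := fderiv_const_smul (((hf.contDiff p.2).differentiable hk') p.1) c
  exact congrArg (fun M => M (p.2.1 : E3)) this

variable (D)

/-! ### Function spaces -/

/-- The space `⋂_{k ≥ 1} C₀^{(k,0,0)}(Ḡ × S × I, Γ₋)`. -/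
def testSpace : Submodule ℝ (Pt → ℝ) where
  carrier := {ψ | ∀ k : ℕ, 1 ≤ k → D.IsCk0Inflow k ψ}
  zero_mem' := fun k _ => ⟨IsCkBar.zero k, by simp [supp]⟩
  add_mem' := by
    intro ψ φ hψ hφ k hk
    refine ⟨(hψ k hk).1.add (hφ k hk).1, ?_⟩
    have hsub : D.supp (ψ + φ) ⊆ D.supp ψ ∪ D.supp φ := by
      rw [supp, supp, supp, ← closure_union, ← inter_union_distrib_left]
      exact closure_mono (inter_subset_inter_right _ (Function.support_add ψ φ))
    rw [← subset_empty_iff]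
    refine (inter_subset_inter_left _ hsub).trans ?_
    rw [union_inter_distrib_right, (hψ k hk).2, (hφ k hk).2, union_empty]
  smul_mem' := by
    intro c ψ hψ k hk
    refine ⟨(hψ k hk).1.smul c, ?_⟩
    have hsub : D.supp (c • ψ) ⊆ D.supp ψ :=
      closure_mono (inter_subset_inter_right _ (Function.support_const_smul_subset c ψ))
    rw [← subset_empty_iff, ← (hψ k hk).2]
    exact inter_subset_inter_left _ hsub

/-- The space `C^{(∞,0,0)}(Ḡ × S × I)`. -/
def smoothSpace : Submodule ℝ (Pt → ℝ) where
  carrier := {φ | D.IsCkBar ⊤ φ}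
  zero_mem' := IsCkBar.zero ⊤
  add_mem' := fun h h' => IsCkBar.add h h'
  smul_mem' := fun c _ h => IsCkBar.smul h c

variable {D} in
theorem isCkBar_of_mem_testSpace {ψ : Pt → ℝ} (h : ψ ∈ D.testSpace) (m : ℕ) :
    D.IsCkBar ((m + 1 : ℕ) : ℕ∞) ψ := (h (m + 1) (by omega)).1

theorem _root_.Transport.MultiIndex.sum_exps_le {m : ℕ} (α : MultiIndex m) :
    ((∑ i, α.exps i : ℕ) : ℕ∞) ≤ ((m + 1 : ℕ) : ℕ∞) := by
  have h : ∑ i, α.exps i ≤ m := α.2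
  exact_mod_cast h.trans (Nat.le_succ m)

/-- Families `(u_α)_{|α| ≤ m}` in `L²(G × S × I)` with the inner product
`⟨u, v⟩ = ∑_{|α| ≤ m} ⟨u_α, v_α⟩_{L²}`.  A function `ψ` with spatial derivatives in `L²` is
identified with the family `(∂ₓ^α ψ)_α`; the function itself is the component `α = 0`. -/
abbrev Jet2 (m : ℕ) : Type := PiLp 2 (fun _ : MultiIndex m => Lp ℝ 2 D.μ)

/-- Families `(s_α)_{|α| ≤ m}` in `L^∞(G × S × I)` with the norm `max_{|α| ≤ m} ‖s_α‖_{L^∞}`. -/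
abbrev JetInf (m : ℕ) : Type := MultiIndex m → Lp ℝ ∞ D.μ

/-- The isometric embedding `ψ ↦ (∂ₓ^α ψ)_α` of the test functions with the inner product of
`H^{(m,0,0)}(G × S × I)`. -/
noncomputable def jet2 (m : ℕ) : D.testSpace →ₗ[ℝ] D.Jet2 m where
  toFun ψ := WithLp.toLp 2 fun α =>
    ((isCkBar_of_mem_testSpace ψ.2 m).memLp 2 α.sum_exps_le).toLp (spatialDeriv α.exps ψ)
  map_add' ψ φ := by
    rw [← WithLp.toLp_add]
    congr 1
    funext α
    exact toLp_add_of_ae _ _ _ ((isCkBar_of_mem_testSpace ψ.2 m).spatialDeriv_add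
      (isCkBar_of_mem_testSpace φ.2 m) α.sum_exps_le)
  map_smul' c ψ := by
    rw [RingHom.id_apply, ← WithLp.toLp_smul]
    congr 1
    funext α
    exact toLp_smul_of_ae _ _ c
      ((isCkBar_of_mem_testSpace ψ.2 m).spatialDeriv_smul c α.sum_exps_le)

/-- The embedding `φ ↦ (∂ₓ^α φ)_α` of `C^{(∞,0,0)}(Ḡ × S × I)` with the norm of
`W^{∞,(m,0,0)}(G × S × I)`. -/
noncomputable def jetInf (m : ℕ) : D.smoothSpace →ₗ[ℝ] D.JetInf m where
  toFun φ := fun α => (IsCkBar.memLp φ.2 ∞ le_top).toLp (spatialDeriv α.exps φ)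
  map_add' ψ φ := by
    funext α
    exact toLp_add_of_ae _ _ _ (IsCkBar.spatialDeriv_add ψ.2 φ.2 le_top)
  map_smul' c ψ := by
    funext α
    exact toLp_smul_of_ae _ _ c (IsCkBar.spatialDeriv_smul ψ.2 c le_top)

/-- The Hilbert space `H₀^{(m,0,0)}(G × S × I, Γ₋)`: the completion of the test functions with
respect to the inner product of `H^{(m,0,0)}(G × S × I)`. -/
noncomputable def H0 (m : ℕ) : Submodule ℝ (D.Jet2 m) :=
  (LinearMap.range (D.jet2 m)).topologicalClosure

/-- The space `𝒲^{∞,(m,0,0)}(G × S × I)`: the completion of `C^{(∞,0,0)}(Ḡ × S × I)` with respect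
to the norm of `W^{∞,(m,0,0)}(G × S × I)`. -/
noncomputable def W (m : ℕ) : Submodule ℝ (D.JetInf m) :=
  (LinearMap.range (D.jetInf m)).topologicalClosure

/-- A test function as an element of `H₀^{(m,0,0)}(G × S × I, Γ₋)`. -/
noncomputable def toH0 (m : ℕ) : D.testSpace →ₗ[ℝ] D.H0 m :=
  (D.jet2 m).codRestrict (D.H0 m) fun ψ =>
    Submodule.le_topologicalClosure _ (LinearMap.mem_range_self _ ψ)

variable {D}

/-- The `L²` function underlying an element of `H₀^{(m,0,0)}(G × S × I, Γ₋)`. -/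
noncomputable def H0.fn {m : ℕ} (u : D.H0 m) : Lp ℝ 2 D.μ := (u : D.Jet2 m) (MultiIndex.zero m)

/-- The `L^∞` function underlying an element of `𝒲^{∞,(m,0,0)}(G × S × I)`. -/
noncomputable def W.fn {m : ℕ} (σ : D.W m) : Lp ℝ ∞ D.μ := (σ : D.JetInf m) (MultiIndex.zero m)

/-- `w ∈ H₀^{(m,0,0)}(G × S × I, Γ₋)` is the product `Σ ψ`. -/
def IsProduct {m : ℕ} (σ : D.W m) (ψ : D.testSpace) (w : D.H0 m) : Prop :=
  H0.fn w =ᵐ[D.μ] fun p => W.fn σ p * (ψ : Pt → ℝ) p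

/-- `f ∈ H₀^{(m,0,0)}(G × S × I, Γ₋)` is `P ψ = ω · ∇ₓ ψ + Σ ψ`. -/
def IsTransportImage {m : ℕ} (σ : D.W m) (ψ : D.testSpace) (f : D.H0 m) : Prop :=
  H0.fn f =ᵐ[D.μ] fun p => streaming (ψ : Pt → ℝ) p + W.fn σ p * (ψ : Pt → ℝ) p

variable (D) in
/-- The inequality `‖Σ ψ‖ ≤ c ‖Σ‖ ‖ψ‖` for all `Σ ∈ 𝒲^{∞,(m,0,0)}(G × S × I)` and all test
functions `ψ`. -/
def ProductBound (m : ℕ) (c : ℝ) : Prop :=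
  ∀ (σ : D.W m) (ψ : D.testSpace) (w : D.H0 m), IsProduct σ ψ w →
    ‖w‖ ≤ c * ‖σ‖ * ‖D.toH0 m ψ‖

/-- The graph of `P_m`: all pairs `(ψ, P ψ)` with `ψ` a test function. -/
def transportGraph {m : ℕ} (σ : D.W m) : Submodule ℝ (D.H0 m × D.H0 m) where
  carrier := {z | ∃ ψ : D.testSpace, D.toH0 m ψ = z.1 ∧ IsTransportImage σ ψ z.2}
  zero_mem' := by
    refine ⟨0, map_zero _, ?_⟩
    have h1 : H0.fn (0 : D.H0 m) = 0 := rfl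
    have h2 : streaming (0 : Pt → ℝ) = 0 := by
      funext p
      simp [streaming]
    simp only [IsTransportImage, Prod.snd_zero, h1, Submodule.coe_zero, h2, Pi.zero_apply,
      mul_zero, add_zero]
    exact Lp.coeFn_zero ℝ 2 D.μ
  add_mem' := by
    rintro z z' ⟨ψ, hψ, h⟩ ⟨φ, hφ, h'⟩
    refine ⟨ψ + φ, by rw [map_add, hψ, hφ, Prod.fst_add], ?_⟩
    have h1 : H0.fn (z + z').2 = H0.fn z.2 + H0.fn z'.2 := rfl
    have h2 := IsCkBar.streaming_add (k := ((0 + 1 : ℕ) : ℕ∞)) (by simp)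
      (isCkBar_of_mem_testSpace ψ.2 0) (isCkBar_of_mem_testSpace φ.2 0)
    unfold IsTransportImage at h h' ⊢
    rw [h1]
    filter_upwards [h, h', h2, Lp.coeFn_add (H0.fn z.2) (H0.fn z'.2)] with p e1 e2 e3 e4
    rw [e4, Pi.add_apply, e1, e2, Submodule.coe_add, e3, Pi.add_apply, Pi.add_apply]
    ring
  smul_mem' := by
    rintro c z ⟨ψ, hψ, h⟩
    refine ⟨c • ψ, by rw [map_smul, hψ, Prod.smul_fst], ?_⟩
    have h1 : H0.fn (c • z).2 = c • H0.fn z.2 := rfl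
    have h2 := IsCkBar.streaming_smul (k := ((0 + 1 : ℕ) : ℕ∞)) (by simp)
      (isCkBar_of_mem_testSpace ψ.2 0) c
    unfold IsTransportImage at h ⊢
    rw [h1]
    filter_upwards [h, h2, Lp.coeFn_smul c (H0.fn z.2)] with p e1 e3 e4
    rw [e4, Pi.smul_apply, e1, Submodule.coe_smul, e3, Pi.smul_apply, Pi.smul_apply]
    simp only [smul_eq_mul]
    ring

/-- The unbounded operator `P_m` in `H₀^{(m,0,0)}(G × S × I, Γ₋)`, whose domain consists of the
test functions and which maps `ψ` to `ω · ∇ₓ ψ + Σ ψ`. -/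
noncomputable def transportOp {m : ℕ} (σ : D.W m) : D.H0 m →ₗ.[ℝ] D.H0 m :=
  (transportGraph σ).toLinearPMap

end Domain

/-- An unbounded operator `A` in a real inner product space is accretive if `⟨A u, u⟩ ≥ 0` for all
`u` in its domain. -/
def IsAccretive {H : Type*} [NormedAddCommGroup H] [InnerProductSpace ℝ H]
    (A : H →ₗ.[ℝ] H) : Prop :=
  ∀ u : A.domain, 0 ≤ inner ℝ (A u) (u : H)

end Transport

/-!
The streaming term is accretive for the inner product of `H₀^{(m,0,0)}`: it commutes with every
`∂ₓ^α`, and `∫_G (θ · ∇u) u` is half the flux of `u²` through `∂G`, to which only the points where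
the direction `θ` leaves `G` contribute when `u` vanishes at the points where it enters.  By the
Leibniz rule, multiplication by `Σ` is bounded by `c(m) ‖Σ‖`, first for smooth `Σ` and then by
density.  Hence `⟨P ψ, ψ⟩ ≥ -c(m) ‖Σ‖ ‖ψ‖²` on test functions.  This one inequality, with the
density of the test functions, makes `P` closable, and it persists under closure.  That a product
or an image is unique as an element of `H₀^{(m,0,0)}` comes from weak derivatives, since an element
of the completion is determined by its underlying `L²` function.
-/

namespace Transport

section IteratedDerivatives

variable {E F : Type*} [NormedAddCommGroup E] [NormedSpace ℝ E] [NormedAddCommGroup F]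
  [NormedSpace ℝ F]

theorem contDiff_fderiv_apply {n : ℕ} {f : E → F} (hf : ContDiff ℝ (n + 1) f) (w : E) :
    ContDiff ℝ n fun y => fderiv ℝ f y w :=
  (hf.fderiv_right le_rfl).clm_apply contDiff_const

theorem fderiv_fderiv_apply_comm {f : E → F} (hf : ContDiff ℝ 2 f) (v w : E) :
    (fun x => fderiv ℝ (fun y => fderiv ℝ f y v) x w) =
      fun x => fderiv ℝ (fun y => fderiv ℝ f y w) x v := by
  funext x
  have hd : DifferentiableAt ℝ (fderiv ℝ f) x :=
    (hf.fderiv_right le_rfl).differentiable one_ne_zero x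
  rw [fderiv_clm_apply hd (differentiableAt_const _),
    fderiv_clm_apply hd (differentiableAt_const _)]
  simpa using hf.contDiffAt.isSymmSndFDerivAt (by simp) w v

theorem iteratedFDeriv_snoc {n : ℕ} {f : E → F} (hf : ContDiff ℝ (n + 1) f) (x : E)
    (v : Fin n → E) (w : E) :
    iteratedFDeriv ℝ (n + 1) f x (Fin.snoc (α := fun _ => E) v w) =
      iteratedFDeriv ℝ n (fun y => fderiv ℝ f y w) x v := by
  rw [iteratedFDeriv_succ_apply_right, Fin.init_snoc, Fin.snoc_last,
    iteratedFDeriv_clm_apply_const_apply (hf.fderiv_right le_rfl) le_rfl]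

theorem iteratedFDeriv_fderiv_apply {n : ℕ} {f : E → F} (hf : ContDiff ℝ (n + 1) f) (x : E)
    (v : Fin n → E) (w : E) :
    iteratedFDeriv ℝ n (fun y => fderiv ℝ f y w) x v =
      fderiv ℝ (fun y => iteratedFDeriv ℝ n f y v) x w := by
  induction n generalizing f with
  | zero => simp
  | succ n ih =>
    obtain ⟨u, a, rfl⟩ : ∃ u a, v = Fin.snoc (α := fun _ => E) u a :=
      ⟨_, _, (Fin.snoc_init_self v).symm⟩
    have hf' : ContDiff ℝ (n + 1) f := hf.of_le (by norm_cast; lia)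
    have hfderiv (b : E) : ContDiff ℝ (n + 1) fun y => fderiv ℝ f y b := by
      exact_mod_cast contDiff_fderiv_apply hf b
    simp only [iteratedFDeriv_snoc hf', iteratedFDeriv_snoc (hfderiv w)]
    rw [fderiv_fderiv_apply_comm (hf.of_le (by norm_cast; lia)), ih (hfderiv a)]

theorem snoc_comp_swap_castSucc {α : Type*} {n : ℕ} (u : Fin n → α) (a : α) (i j : Fin n) :
    Fin.snoc (α := fun _ => α) u a ∘ Equiv.swap i.castSucc j.castSucc =
      Fin.snoc (α := fun _ => α) (u ∘ Equiv.swap i j) a := by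
  funext k
  induction k using Fin.lastCases with
  | last =>
    simp [Equiv.swap_apply_of_ne_of_ne (Fin.castSucc_ne_last i).symm (Fin.castSucc_ne_last j).symm]
  | cast k =>
    simp only [Function.comp_apply, Fin.snoc_castSucc, Equiv.swap_apply_def, Fin.castSucc_inj]
    split_ifs <;> simp only [Fin.snoc_castSucc]

theorem snoc_snoc_comp_swap_last {α : Type*} {n : ℕ} (u : Fin n → α) (a b : α) :
    Fin.snoc (α := fun _ => α) (Fin.snoc (α := fun _ => α) u b) a ∘
        Equiv.swap (Fin.last n).castSucc (Fin.last (n + 1)) =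
      Fin.snoc (α := fun _ => α) (Fin.snoc (α := fun _ => α) u a) b := by
  funext k
  induction k using Fin.lastCases with
  | last =>
    simp only [Function.comp_apply, Equiv.swap_apply_right, Fin.snoc_castSucc, Fin.snoc_last]
  | cast k =>
    induction k using Fin.lastCases with
    | last =>
      simp only [Function.comp_apply, Equiv.swap_apply_left, Fin.snoc_castSucc, Fin.snoc_last]
    | cast k =>
      have hk : k.castSucc.castSucc ≠ (Fin.last n).castSucc :=
        Fin.castSucc_injective _ |>.ne (Fin.castSucc_ne_last k)
      simp only [Function.comp_apply,
        Equiv.swap_apply_of_ne_of_ne hk (Fin.castSucc_ne_last _), Fin.snoc_castSucc]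

theorem iteratedFDeriv_comp_swap {n : ℕ} {f : E → F} (hf : ContDiff ℝ (n + 1) f) (x : E)
    (v : Fin (n + 1) → E) (i : Fin n) :
    iteratedFDeriv ℝ (n + 1) f x (v ∘ Equiv.swap i.castSucc i.succ) =
      iteratedFDeriv ℝ (n + 1) f x v := by
  induction n generalizing f with
  | zero => exact i.elim0
  | succ n ih =>
    have hfderiv (b : E) : ContDiff ℝ (n + 1) fun y => fderiv ℝ f y b := by
      exact_mod_cast contDiff_fderiv_apply hf b
    obtain ⟨u, a, rfl⟩ : ∃ u a, v = Fin.snoc (α := fun _ => E) u a :=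
      ⟨_, _, (Fin.snoc_init_self v).symm⟩
    induction i using Fin.lastCases with
    | cast j =>
      rw [Fin.succ_castSucc, snoc_comp_swap_castSucc, iteratedFDeriv_snoc hf, ih (hfderiv a),
        iteratedFDeriv_snoc hf]
    | last =>
      obtain ⟨u, b, rfl⟩ : ∃ u' b, u = Fin.snoc (α := fun _ => E) u' b :=
        ⟨_, _, (Fin.snoc_init_self u).symm⟩
      rw [Fin.succ_last, snoc_snoc_comp_swap_last, iteratedFDeriv_snoc hf,
        iteratedFDeriv_snoc hf, iteratedFDeriv_snoc (hfderiv _), iteratedFDeriv_snoc (hfderiv _),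
        fderiv_fderiv_apply_comm (hf.of_le (by norm_cast; lia))]

theorem iteratedFDeriv_comp_perm {n : ℕ} {f : E → F} (hf : ContDiff ℝ n f) (x : E)
    (v : Fin n → E) (σ : Equiv.Perm (Fin n)) :
    iteratedFDeriv ℝ n f x (v ∘ σ) = iteratedFDeriv ℝ n f x v := by
  cases n with
  | zero => simp
  | succ n =>
    have hσ : σ ∈ Submonoid.closure (range fun i : Fin n => Equiv.swap i.castSucc i.succ) := by
      rw [Equiv.Perm.mclosure_swap_castSucc_succ]
      trivial
    induction hσ using Submonoid.closure_induction generalizing v with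
    | mem σ hσ =>
      obtain ⟨i, rfl⟩ := hσ
      exact iteratedFDeriv_comp_swap (mod_cast hf) x v i
    | one => rfl
    | mul σ τ _ _ hσ hτ =>
      rw [Equiv.Perm.coe_mul, ← Function.comp_assoc, hτ, hσ]

end IteratedDerivatives

section ContDiffFst

variable {E Y : Type*} [NormedAddCommGroup E] [NormedSpace ℝ E] [TopologicalSpace Y]

/-- Functions of `(x, y)` that are `k` times continuously differentiable in `x`, with derivatives
jointly continuous in `(x, y)`.  The continuity of the derivatives is required for each fixed list
of directions, which for finite-dimensional `E` is continuity in the operator norm. -/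
def ContDiffFst (k : ℕ) (f : E × Y → ℝ) : Prop :=
  (∀ y, ContDiff ℝ k fun x => f (x, y)) ∧
    ∀ n ≤ k, ∀ v : Fin n → E, Continuous fun p : E × Y =>
      iteratedFDeriv ℝ n (fun x => f (x, p.2)) p.1 v

namespace ContDiffFst

variable {k : ℕ} {f g : E × Y → ℝ}

theorem of_le {l : ℕ} (hf : ContDiffFst k f) (hl : l ≤ k) : ContDiffFst l f :=
  ⟨fun y => (hf.1 y).of_le (mod_cast hl), fun n hn => hf.2 n (hn.trans hl)⟩

theorem continuous (hf : ContDiffFst k f) : Continuous f := by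
  simpa using hf.2 0 k.zero_le Fin.elim0

theorem differentiable (hf : ContDiffFst (k + 1) f) (y : Y) :
    Differentiable ℝ fun x => f (x, y) :=
  (hf.1 y).differentiable (mod_cast k.succ_ne_zero)

theorem zero_iff : ContDiffFst 0 f ↔ Continuous f := by
  refine ⟨continuous, fun hf => ⟨fun y => ?_, fun n hn => ?_⟩⟩
  · exact_mod_cast contDiff_zero.mpr (hf.comp (Continuous.prodMk_left y))
  · obtain rfl := Nat.le_zero.mp hn
    simpa using hf

theorem add (hf : ContDiffFst k f) (hg : ContDiffFst k g) : ContDiffFst k (f + g) := by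
  refine ⟨fun y => (hf.1 y).add (hg.1 y), fun n hn v => ?_⟩
  refine ((hf.2 n hn v).add (hg.2 n hn v)).congr fun p => ?_
  have hn' : (n : WithTop ℕ∞) ≤ k := mod_cast hn
  exact (congrArg (· v) (iteratedFDeriv_add_apply (x := p.1)
    ((hf.1 p.2).of_le hn').contDiffAt ((hg.1 p.2).of_le hn').contDiffAt)).symm

variable [FiniteDimensional ℝ E]

theorem succ_iff : ContDiffFst (k + 1) f ↔ Continuous f ∧
    (∀ y, Differentiable ℝ fun x => f (x, y)) ∧
    ∀ v, ContDiffFst k fun p : E × Y => fderiv ℝ (fun x => f (x, p.2)) p.1 v := by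
  constructor
  · intro hf
    have hslice (y : Y) : ContDiff ℝ (k + 1) fun x => f (x, y) := mod_cast hf.1 y
    refine ⟨hf.continuous, hf.differentiable, fun v => ⟨fun y => ?_, fun n hn u => ?_⟩⟩
    · exact contDiff_fderiv_apply (hslice y) v
    · refine (hf.2 (n + 1) (by lia) (Fin.snoc u v)).congr fun p => ?_
      exact iteratedFDeriv_snoc ((hslice p.2).of_le (mod_cast Nat.succ_le_succ hn)) p.1 u v
  · rintro ⟨hcont, hdiff, hderiv⟩
    have hslice (y : Y) : ContDiff ℝ (k + 1) fun x => f (x, y) :=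
      contDiff_succ_iff_fderiv_apply.mpr ⟨hdiff y, by simp, fun v => (hderiv v).1 y⟩
    refine ⟨fun y => mod_cast hslice y, fun n hn u => ?_⟩
    cases n with
    | zero => simpa using hcont
    | succ n =>
      refine ((hderiv (u (Fin.last n))).2 n (by lia) (Fin.init u)).congr fun p => ?_
      rw [← iteratedFDeriv_snoc ((hslice p.2).of_le (mod_cast hn)), Fin.snoc_init_self]

theorem comp_snd {θ : Y → ℝ} (hθ : Continuous θ) : ContDiffFst k fun p : E × Y => θ p.2 := by
  induction k generalizing θ with
  | zero => exact zero_iff.mpr (hθ.comp continuous_snd)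
  | succ k ih =>
    refine succ_iff.mpr ⟨hθ.comp continuous_snd, fun y => differentiable_const (θ y), fun v => ?_⟩
    simpa using ih continuous_zero

theorem mul (hf : ContDiffFst k f) (hg : ContDiffFst k g) : ContDiffFst k (f * g) := by
  induction k generalizing f g with
  | zero => exact zero_iff.mpr (hf.continuous.mul hg.continuous)
  | succ k ih =>
    refine succ_iff.mpr ⟨hf.continuous.mul hg.continuous,
      fun y => (hf.differentiable y).mul (hg.differentiable y), fun v => ?_⟩
    convert (ih (hf.of_le k.le_succ) ((succ_iff.mp hg).2.2 v)).add
      (ih (hg.of_le k.le_succ) ((succ_iff.mp hf).2.2 v)) using 1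
    funext p
    exact congrArg (· v) (fderiv_mul (hf.differentiable p.2 p.1) (hg.differentiable p.2 p.1))

theorem fderiv_apply (hf : ContDiffFst (k + 1) f) {θ : Y → E} (hθ : Continuous θ) :
    ContDiffFst k fun p : E × Y => fderiv ℝ (fun x => f (x, p.2)) p.1 (θ p.2) := by
  let b := Module.finBasis ℝ E
  have hsum : (fun p : E × Y => fderiv ℝ (fun x => f (x, p.2)) p.1 (θ p.2)) =
      ∑ i, (fun p : E × Y => b.equivFun (θ p.2) i) *
        fun p : E × Y => fderiv ℝ (fun x => f (x, p.2)) p.1 (b i) := by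
    funext p
    refine (congrArg (fderiv ℝ (fun x => f (x, p.2)) p.1) (b.sum_equivFun (θ p.2)).symm).trans ?_
    simp only [map_sum, map_smul, smul_eq_mul, Finset.sum_apply, Pi.mul_apply]
  rw [hsum]
  refine Finset.sum_induction _ (ContDiffFst k) (fun _ _ => add) (comp_snd continuous_zero)
    fun i _ => ?_
  have hcoord : Continuous fun y => b.equivFun (θ y) i :=
    (continuous_apply i).comp (b.equivFunL.continuous.comp hθ)
  exact (comp_snd hcoord).mul ((succ_iff.mp hf).2.2 (b i))

end ContDiffFst

end ContDiffFst

section SpatialDerivatives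

theorem multiDir_finSigmaFinEquiv (a : Fin 3 → ℕ) (s : Σ i, Fin (a i)) :
    multiDir a (finSigmaFinEquiv s) = EuclideanSpace.single s.1 1 := by
  obtain ⟨i, k, hk⟩ := s
  rw [multiDir, finSigmaFinEquiv_apply]
  congr 1
  fin_cases i <;> (simp_all [Fin.sum_univ_succ]; try lia)

theorem norm_multiDir (a : Fin 3 → ℕ) (j : Fin (∑ i, a i)) : ‖multiDir a j‖ = 1 := by
  simp [multiDir]

theorem exists_equiv_multiDir {n : ℕ} (r : Fin n → Fin 3) :
    ∃ (a : Fin 3 → ℕ) (e : Fin n ≃ Fin (∑ i, a i)),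
      (fun j => EuclideanSpace.single (r j) 1) = multiDir a ∘ e := by
  let a : Fin 3 → ℕ := fun i => Fintype.card {j // r j = i}
  let e : Fin n ≃ Σ i, Fin (a i) :=
    (Equiv.sigmaFiberEquiv r).symm.trans (Equiv.sigmaCongrRight fun _ => Fintype.equivFin _)
  exact ⟨a, e.trans finSigmaFinEquiv, funext fun j => (multiDir_finSigmaFinEquiv a (e j)).symm⟩

theorem exists_spatialDeriv_eq_iteratedFDeriv {n : ℕ} (r : Fin n → Fin 3) :
    ∃ a : Fin 3 → ℕ, ∑ i, a i = n ∧ ∀ (f : Pt → ℝ), (∀ q, ContDiff ℝ n fun x => f (x, q)) →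
      ∀ p, iteratedFDeriv ℝ n (fun x => f (x, p.2)) p.1
        (fun j => EuclideanSpace.single (r j) 1) = spatialDeriv a f p := by
  obtain ⟨a, e, he⟩ := exists_equiv_multiDir r
  obtain rfl : n = ∑ i, a i := by simpa using Fintype.card_congr e
  exact ⟨a, rfl, fun f hf p => by rw [he, iteratedFDeriv_comp_perm (hf p.2)]; rfl⟩

theorem iteratedFDeriv_apply_eq_sum {n : ℕ} (f : Pt → ℝ) (p : Pt) (v : Fin n → E3) :
    iteratedFDeriv ℝ n (fun x => f (x, p.2)) p.1 v =
      ∑ r : Fin n → Fin 3, (∏ j, v j (r j)) *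
        iteratedFDeriv ℝ n (fun x => f (x, p.2)) p.1 fun j => EuclideanSpace.single (r j) 1 := by
  have hv : v = fun j => ∑ i, v j i • EuclideanSpace.single i (1 : ℝ) := by
    funext j
    simpa using ((EuclideanSpace.basisFun (Fin 3) ℝ).sum_repr (v j)).symm
  conv_lhs => rw [hv, ContinuousMultilinearMap.map_sum]
  simp only [ContinuousMultilinearMap.map_smul_univ, smul_eq_mul]

theorem norm_iteratedFDeriv_le_of_spatialDeriv {n : ℕ} {f : Pt → ℝ}
    (hf : ∀ q, ContDiff ℝ n fun x => f (x, q)) (p : Pt) {M : ℝ}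
    (hM : ∀ a, ∑ i, a i = n → |spatialDeriv a f p| ≤ M) :
    ‖iteratedFDeriv ℝ n (fun x => f (x, p.2)) p.1‖ ≤ 3 ^ n * M := by
  have hbasis (r : Fin n → Fin 3) : |iteratedFDeriv ℝ n (fun x => f (x, p.2)) p.1
      fun j => EuclideanSpace.single (r j) 1| ≤ M := by
    obtain ⟨a, ha, hspatial⟩ := exists_spatialDeriv_eq_iteratedFDeriv r
    exact hspatial f hf p ▸ hM a ha
  have hM0 : 0 ≤ M := (abs_nonneg _).trans (hbasis 0)
  refine ContinuousMultilinearMap.opNorm_le_bound (by positivity) fun v => ?_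
  rw [iteratedFDeriv_apply_eq_sum, Real.norm_eq_abs]
  calc |_| ≤ ∑ r : Fin n → Fin 3, |(∏ j, v j (r j)) * _| := Finset.abs_sum_le_sum_abs _ _
    _ ≤ ∑ _r : Fin n → Fin 3, (∏ j, ‖v j‖) * M := by
      refine Finset.sum_le_sum fun r _ => ?_
      rw [abs_mul, Finset.abs_prod]
      gcongr with j
      · exact PiLp.norm_apply_le (v j) (r j)
      · exact hbasis r
    _ = 3 ^ n * M * ∏ j, ‖v j‖ := by
      simp only [Finset.sum_const, Finset.card_univ, Fintype.card_fun, Fintype.card_fin,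
        nsmul_eq_mul, Nat.cast_pow, Nat.cast_ofNat]
      ring

theorem isCk0_iff {k : ℕ} {f : Pt → ℝ} :
    IsCk0 k f ↔ ContDiffFst k f ∧ HasCompactSupport f := by
  refine ⟨fun hf => ⟨⟨hf.contDiff, fun n hn v => ?_⟩, hf.hasCompactSupport⟩, fun hf => ?_⟩
  · refine Continuous.congr ?_ fun p => (iteratedFDeriv_apply_eq_sum f p v).symm
    refine continuous_finsetSum _ fun r _ => continuous_const.mul ?_
    obtain ⟨a, ha, hspatial⟩ := exists_spatialDeriv_eq_iteratedFDeriv r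
    exact (hf.continuous a (by rw [ha]; exact_mod_cast hn)).congr fun p =>
      (hspatial f (fun q => (hf.contDiff q).of_le (mod_cast hn)) p).symm
  · exact ⟨hf.1.1, fun a ha => hf.1.2 _ (mod_cast ha) _, hf.2⟩

theorem IsCk0.of_le {k l : ℕ∞} {f : Pt → ℝ} (hf : IsCk0 l f) (hkl : k ≤ l) : IsCk0 k f where
  contDiff q := (hf.contDiff q).of_le (mod_cast hkl)
  continuous a ha := hf.continuous a (ha.trans hkl)
  hasCompactSupport := hf.hasCompactSupport

theorem IsCk0.mul {k : ℕ} {f g : Pt → ℝ} (hf : IsCk0 k f) (hg : IsCk0 k g) : IsCk0 k (f * g) := by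
  rw [isCk0_iff] at *
  exact ⟨hf.1.mul hg.1, hf.2.mul_right⟩

theorem support_streaming_subset (f : Pt → ℝ) : Function.support (streaming f) ⊆ tsupport f := by
  intro p hp
  by_contra hn
  have hslice : (fun x => f (x, p.2)) =ᶠ[nhds p.1] 0 :=
    (Continuous.prodMk_left p.2).continuousAt.eventually (notMem_tsupport_iff_eventuallyEq.mp hn)
  exact hp (by simp [streaming, hslice.fderiv_eq])

theorem IsCk0.streaming {k : ℕ} {f : Pt → ℝ} (hf : IsCk0 ((k + 1 : ℕ) : ℕ∞) f) :
    IsCk0 k (streaming f) := by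
  rw [isCk0_iff] at *
  exact ⟨hf.1.fderiv_apply (continuous_subtype_val.comp continuous_fst),
    hf.2.mono' (support_streaming_subset f)⟩

theorem spatialDeriv_streaming {a : Fin 3 → ℕ} {f : Pt → ℝ}
    (hf : ∀ q, ContDiff ℝ (∑ i, a i + 1 : ℕ) fun x => f (x, q)) :
    spatialDeriv a (streaming f) = streaming (spatialDeriv a f) :=
  funext fun p =>
    iteratedFDeriv_fderiv_apply (f := fun x => f (x, p.2)) (mod_cast hf p.2) p.1
      (multiDir a) p.2.1

theorem spatialDeriv_zero (f : Pt → ℝ) : spatialDeriv 0 f = f := by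
  funext p
  have hzero (n : ℕ) (hn : n = 0) (v : Fin n → E3) :
      iteratedFDeriv ℝ n (fun x => f (x, p.2)) p.1 v = f p := by
    subst hn
    exact iteratedFDeriv_zero_apply v
  exact hzero _ (by simp) _

theorem abs_spatialDeriv_mul_le {a : Fin 3 → ℕ} {f g : Pt → ℝ}
    (hf : ∀ q, ContDiff ℝ (∑ i, a i : ℕ) fun x => f (x, q))
    (hg : ∀ q, ContDiff ℝ (∑ i, a i : ℕ) fun x => g (x, q)) {p : Pt} {M N : ℝ}
    (hM : ∀ b : Fin 3 → ℕ, ∑ i, b i ≤ ∑ i, a i → |spatialDeriv b f p| ≤ M)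
    (hN : ∀ b : Fin 3 → ℕ, ∑ i, b i ≤ ∑ i, a i → |spatialDeriv b g p| ≤ N) :
    |spatialDeriv a (f * g) p| ≤ 6 ^ (∑ i, a i) * (M * N) := by
  set n := ∑ i, a i
  have hM0 : 0 ≤ M := (abs_nonneg _).trans (hM 0 (by simp))
  have hbound {h : Pt → ℝ} {K : ℝ} (hh : ∀ q, ContDiff ℝ n fun x => h (x, q))
      (hK : ∀ b : Fin 3 → ℕ, ∑ i, b i ≤ n → |spatialDeriv b h p| ≤ K) {l : ℕ} (hl : l ≤ n) :
      ‖iteratedFDeriv ℝ l (fun x => h (x, p.2)) p.1‖ ≤ 3 ^ l * K :=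
    norm_iteratedFDeriv_le_of_spatialDeriv (fun q => (hh q).of_le (mod_cast hl)) p
      fun b hb => hK b (hb.trans_le hl)
  calc |spatialDeriv a (f * g) p|
      ≤ ‖iteratedFDeriv ℝ n (fun x => f (x, p.2) * g (x, p.2)) p.1‖ := by
        have hop := (iteratedFDeriv ℝ n (fun x => f (x, p.2) * g (x, p.2)) p.1).le_opNorm
          (multiDir a)
        simp only [norm_multiDir, Finset.prod_const_one, mul_one] at hop
        exact hop
    _ ≤ ∑ l ∈ Finset.range (n + 1), n.choose l *
          ‖iteratedFDeriv ℝ l (fun x => f (x, p.2)) p.1‖ *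
          ‖iteratedFDeriv ℝ (n - l) (fun x => g (x, p.2)) p.1‖ :=
        norm_iteratedFDeriv_mul_le (hf p.2) (hg p.2) p.1 le_rfl
    _ ≤ ∑ l ∈ Finset.range (n + 1), n.choose l * (3 ^ l * M) * (3 ^ (n - l) * N) := by
        refine Finset.sum_le_sum fun l hl => ?_
        gcongr
        · exact hbound hf hM (by simpa [Nat.lt_succ_iff] using hl)
        · exact hbound hg hN (Nat.sub_le n l)
    _ = 6 ^ n * (M * N) := by
        rw [show (6 : ℝ) ^ n = (3 + 3) ^ n by norm_num, add_pow, Finset.sum_mul]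
        exact Finset.sum_congr rfl fun l _ => by ring

end SpatialDerivatives

theorem integral_nonneg_of_tendsto_of_le {α : Type*} [MeasurableSpace α] {μ : Measure α}
    {F : ℕ → α → ℝ} {f g : α → ℝ} (hF : ∀ n, Integrable (F n) μ) (hf : Integrable f μ)
    (hg : Integrable g μ) (hFg : ∀ n, F n ≤ᵐ[μ] g)
    (hlim : ∀ᵐ x ∂μ, Filter.Tendsto (fun n => F n x) Filter.atTop (nhds (f x)))
    (hnonneg : ∀ n, 0 ≤ ∫ x, F n x ∂μ) : 0 ≤ ∫ x, f x ∂μ := by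
  -- Only an upper bound on `F n` is available; truncation from below makes the sequence dominated
  -- without changing the limit or decreasing the integrals.
  let H : ℕ → α → ℝ := fun n x => max (F n x) (-|f x|)
  have hH (n : ℕ) : Integrable (H n) μ := (hF n).sup hf.abs.neg
  have hHlim : ∀ᵐ x ∂μ, Filter.Tendsto (fun n => H n x) Filter.atTop (nhds (f x)) := by
    filter_upwards [hlim] with x hx
    simpa only [max_eq_left (neg_abs_le (f x))] using hx.max (tendsto_const_nhds (x := -|f x|))
  have hHbound (n : ℕ) : ∀ᵐ x ∂μ, ‖H n x‖ ≤ |f x| + |g x| := by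
    filter_upwards [hFg n] with x hx
    have hgx := le_abs_self (g x)
    have hfx := abs_nonneg (f x)
    have hgx' := abs_nonneg (g x)
    exact abs_le.mpr ⟨(by linarith : _ ≤ -|f x|).trans (le_max_right _ _),
      max_le (by linarith) (by linarith)⟩
  refine ge_of_tendsto' (tendsto_integral_of_dominated_convergence (fun x => |f x| + |g x|)
    (fun n => (hH n).aestronglyMeasurable) (hf.abs.add hg.abs) hHbound hHlim) fun n => ?_
  exact (hnonneg n).trans (integral_mono (hF n) (hH n) fun x => le_max_left _ _)

theorem setIntegral_sub_translate_nonneg {E : Type*} [AddGroup E] [MeasurableSpace E]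
    [MeasurableAdd E] {μ : Measure E} [μ.IsAddRightInvariant] {G : Set E} {v : E → ℝ}
    (hv : Integrable v μ) (hv0 : 0 ≤ v) (hvG : ∀ x ∉ G, v x = 0) (c : E) :
    0 ≤ ∫ x in G, (v x - v (x - c)) ∂μ := by
  have hvc : Integrable (fun x => v (x - c)) μ := hv.comp_sub_right c
  rw [integral_sub hv.integrableOn hvc.integrableOn, sub_nonneg]
  calc ∫ x in G, v (x - c) ∂μ ≤ ∫ x, v (x - c) ∂μ :=
        setIntegral_le_integral hvc (.of_forall fun x => hv0 (x - c))
    _ = ∫ x, v x ∂μ := integral_sub_right_eq_self v c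
    _ = ∫ x in G, v x ∂μ := (setIntegral_eq_integral_of_forall_compl_eq_zero hvG).symm

section Flux

variable {E : Type*} [NormedAddCommGroup E] [NormedSpace ℝ E] {G : Set E} {θ y : E}

/-- `y` is a point through which a line with direction `θ` enters the set `G`. -/
def IsEntryPoint (G : Set E) (θ y : E) : Prop :=
  y ∉ G ∧ ∀ᶠ t in nhdsWithin (0 : ℝ) (Ioi 0), y + t • θ ∈ G

theorem tendsto_add_smul_nhdsGT (θ y : E) :
    Filter.Tendsto (fun t : ℝ => y + t • θ) (nhdsWithin 0 (Ioi 0)) (nhds y) := by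
  have hcont : Continuous fun t : ℝ => y + t • θ := by fun_prop
  simpa only [zero_smul, add_zero] using (hcont.tendsto 0).mono_left nhdsWithin_le_nhds

theorem IsEntryPoint.mem_frontier (hy : IsEntryPoint G θ y) (hG : IsOpen G) : y ∈ frontier G := by
  rw [hG.frontier_eq]
  exact ⟨mem_closure_of_tendsto (tendsto_add_smul_nhdsGT θ y) hy.2, hy.1⟩

theorem IsEntryPoint.fderiv_nonpos (hy : IsEntryPoint G θ y) {φ : E → ℝ}
    (hφ : DifferentiableAt ℝ φ y) (hφG : ∀ᶠ x in nhds y, x ∈ G ↔ φ x < 0) :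
    fderiv ℝ φ y θ ≤ 0 := by
  have hφy : 0 ≤ φ y := not_lt.mp fun h => hy.1 (hφG.self_of_nhds.mpr h)
  refine le_of_tendsto (hφ.hasFDerivAt.hasLineDerivAt θ).tendsto_slope_zero_right ?_
  filter_upwards [hy.2, (tendsto_add_smul_nhdsGT θ y).eventually hφG, self_mem_nhdsWithin]
    with t ht htφ ht0
  rw [smul_eq_mul]
  exact mul_nonpos_of_nonneg_of_nonpos (inv_nonneg.mpr (le_of_lt ht0))
    (by linarith [htφ.mp ht])

theorem exists_isEntryPoint (hG : IsOpen G) {x : E} (hx : x ∈ G) {h : ℝ} (hh : 0 ≤ h)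
    (hxh : x - h • θ ∉ G) : ∃ a ∈ Icc 0 h, IsEntryPoint G θ (x - a • θ) := by
  have hcompact : IsCompact (Icc 0 h ∩ (fun s : ℝ => x - s • θ) ⁻¹' Gᶜ) :=
    isCompact_Icc.inter_right (hG.isClosed_compl.preimage (by fun_prop))
  obtain ⟨a, ⟨ha, haG⟩, hleast⟩ := hcompact.exists_isLeast ⟨h, ⟨hh, le_rfl⟩, hxh⟩
  have ha0 : 0 < a := ha.1.lt_of_ne fun h0 => haG (by simpa [← h0] using hx)
  refine ⟨a, ha, haG, ?_⟩
  filter_upwards [Ioc_mem_nhdsGT ha0] with t ht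
  by_contra hnot
  have heq : x - a • θ + t • θ = x - (a - t) • θ := by module
  have hle : a ≤ a - t :=
    hleast ⟨⟨sub_nonneg.mpr ht.2, (sub_le_self a ht.1.le).trans ha.2⟩,
      by simpa only [mem_preimage, mem_compl_iff, ← heq] using hnot⟩
  exact absurd ht.1 (by linarith)

theorem indicator_sub_indicator_translate_le (hG : IsOpen G) {w : E → ℝ} {L : NNReal}
    (hw : LipschitzWith L w) (hentry : ∀ y, IsEntryPoint G θ y → w y = 0) {x : E} (hx : x ∈ G)
    {h : ℝ} (hh : 0 ≤ h) :
    G.indicator w x - G.indicator w (x - h • θ) ≤ L * ‖θ‖ * h := by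
  have hlip (a : ℝ) (ha : 0 ≤ a) : w x - w (x - a • θ) ≤ L * ‖θ‖ * a := by
    calc w x - w (x - a • θ) ≤ ‖w x - w (x - a • θ)‖ := Real.le_norm_self _
      _ ≤ L * ‖x - (x - a • θ)‖ := hw.norm_sub_le _ _
      _ = L * ‖θ‖ * a := by rw [sub_sub_cancel, norm_smul, Real.norm_of_nonneg ha]; ring
  rw [indicator_of_mem hx]
  by_cases hxh : x - h • θ ∈ G
  · rw [indicator_of_mem hxh]
    exact hlip h hh
  · obtain ⟨a, ha, hya⟩ := exists_isEntryPoint hG hx hh hxh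
    calc w x - G.indicator w (x - h • θ) = w x - w (x - a • θ) := by
          rw [indicator_of_notMem hxh, hentry _ hya]
      _ ≤ L * ‖θ‖ * a := hlip a ha.1
      _ ≤ L * ‖θ‖ * h := by gcongr; exact ha.2

theorem tendsto_backward_quotient {v : E → ℝ} {x : E} (hv : DifferentiableAt ℝ v x) (θ : E) :
    Filter.Tendsto (fun n : ℕ => n * (v x - v (x - (n : ℝ)⁻¹ • θ))) Filter.atTop
      (nhds (fderiv ℝ v x θ)) := by
  have hquot := ((hv.hasFDerivAt.lim_real (-θ)).comp tendsto_natCast_atTop_atTop).neg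
  rw [map_neg, neg_neg] at hquot
  refine hquot.congr fun n => ?_
  simp only [Function.comp_apply, smul_neg, smul_eq_mul, ← sub_eq_add_neg]
  ring

variable [MeasurableSpace E] [BorelSpace E] {μ : Measure E} [μ.IsAddHaarMeasure]

-- Instead of the divergence theorem, the integral is a limit of difference quotients of the
-- extension of `w` by zero: their integrals are nonnegative by translation invariance, and since
-- this extension can only jump downwards along `θ`, they are bounded above.
theorem setIntegral_fderiv_nonneg (hG : IsOpen G) (hGμ : μ G ≠ ⊤) {w : E → ℝ}
    (hw : ContDiff ℝ 1 w) (hwc : HasCompactSupport w) (hw0 : 0 ≤ w)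
    (hentry : ∀ y, IsEntryPoint G θ y → w y = 0) : 0 ≤ ∫ x in G, fderiv ℝ w x θ ∂μ := by
  obtain ⟨L, hL⟩ := ContDiff.lipschitzWith_of_hasCompactSupport hwc hw one_ne_zero
  let v : E → ℝ := G.indicator w
  have hv : Integrable v μ :=
    (hw.continuous.integrable_of_hasCompactSupport hwc).indicator hG.measurableSet
  have hvw {x : E} (hx : x ∈ G) : v =ᶠ[nhds x] w :=
    Filter.eventuallyEq_of_mem (hG.mem_nhds hx) (eqOn_indicator (f := w))
  have hderiv : Integrable (fun x => fderiv ℝ w x θ) μ :=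
    ((hw.continuous_fderiv one_ne_zero).clm_apply continuous_const).integrable_of_hasCompactSupport
      (hwc.fderiv_apply ℝ θ)
  refine integral_nonneg_of_tendsto_of_le
    (F := fun n x => n * (v x - v (x - (n : ℝ)⁻¹ • θ))) (g := fun _ => L * ‖θ‖)
    (fun n => ((hv.sub (hv.comp_sub_right _)).const_mul _).integrableOn) hderiv.integrableOn
    (integrableOn_const hGμ) (fun n => ?_) ?_ fun n => ?_
  · filter_upwards [ae_restrict_mem hG.measurableSet] with x hx
    calc n * (v x - v (x - (n : ℝ)⁻¹ • θ)) ≤ n * (L * ‖θ‖ * (n : ℝ)⁻¹) := by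
          gcongr
          exact indicator_sub_indicator_translate_le hG hL hentry hx (by positivity)
      _ = L * ‖θ‖ * (n * (n : ℝ)⁻¹) := by ring
      _ ≤ L * ‖θ‖ := mul_le_of_le_one_right (by positivity) mul_inv_le_one
  · filter_upwards [ae_restrict_mem hG.measurableSet] with x hx
    rw [← (hvw hx).fderiv_eq]
    exact tendsto_backward_quotient
      ((hvw hx).differentiableAt_iff.mpr (hw.differentiable one_ne_zero x)) θ
  · rw [integral_const_mul]
    exact mul_nonneg n.cast_nonneg (setIntegral_sub_translate_nonneg hv
      (indicator_nonneg fun x _ => hw0 x) (fun x hx => indicator_of_notMem hx w) _)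

theorem setIntegral_fderiv_mul_self_nonneg (hG : IsOpen G) (hGμ : μ G ≠ ⊤) {u : E → ℝ}
    (hu : ContDiff ℝ 1 u) (huc : HasCompactSupport u)
    (hentry : ∀ y, IsEntryPoint G θ y → u y = 0) :
    0 ≤ ∫ x in G, fderiv ℝ u x θ * u x ∂μ := by
  have hsq (x : E) : fderiv ℝ (u * u) x θ = 2 * (fderiv ℝ u x θ * u x) := by
    have hux := hu.differentiable one_ne_zero x
    simp only [fderiv_mul hux hux, add_apply, smul_apply, smul_eq_mul]
    ring
  have hflux : 0 ≤ ∫ x in G, fderiv ℝ (u * u) x θ ∂μ :=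
    setIntegral_fderiv_nonneg hG hGμ (hu.mul hu) huc.mul_right
      (fun x => mul_self_nonneg (u x)) fun y hy => by simp [hentry y hy]
  simp only [hsq, integral_const_mul] at hflux
  linarith

end Flux

namespace Domain

variable {D : Domain}

theorem mem_inflow_of_isEntryPoint {y : E3} {q : S2 × ℝ} (hy : IsEntryPoint D.G (q.1 : E3) y)
    (hq : q.2 ∈ Icc D.E₀ D.E₁) : ((y, q) : Pt) ∈ D.Γminus ∪ D.Γzero := by
  have hfr := hy.mem_frontier D.isOpen
  obtain ⟨φ, hφ⟩ := D.smooth_boundary y hfr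
  have hnormal : IsOutwardUnitNormal D.G y (‖gradient φ y‖⁻¹ • gradient φ y) := ⟨φ, hφ, rfl⟩
  obtain ⟨U, hU, hyU, hφU, -, hGU⟩ := hφ
  have hφy : DifferentiableAt ℝ φ y :=
    (hφU.differentiableOn (by norm_num)).differentiableAt (hU.mem_nhds hyU)
  have hinner : inner ℝ (q.1 : E3) (‖gradient φ y‖⁻¹ • gradient φ y) ≤ 0 := by
    rw [inner_smul_right, real_inner_comm, inner_gradient_left]
    exact mul_nonpos_of_nonneg_of_nonpos (by positivity)
      (hy.fderiv_nonpos hφy (Filter.eventually_of_mem (hU.mem_nhds hyU) hGU))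
  exact hinner.lt_or_eq.imp (fun h => ⟨hfr, hq, _, hnormal, h⟩) fun h => ⟨hfr, hq, _, hnormal, h⟩

theorem slice_eventuallyEq_zero {ψ : Pt → ℝ} {p : Pt} (hp : p ∈ D.Ω) (hψ : p ∉ D.supp ψ) :
    (fun x => ψ (x, p.2)) =ᶠ[nhds p.1] 0 := by
  have hsupp : ∀ᶠ x in nhds p.1, ((x, p.2) : Pt) ∉ D.supp ψ :=
    (Continuous.prodMk_left p.2).continuousAt.eventually (isClosed_closure.isOpen_compl.mem_nhds hψ)
  filter_upwards [mem_nhds_slice hp, hsupp] with x hxΩ hx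
  by_contra hne
  exact hx (subset_closure ⟨hxΩ, hne⟩)

theorem spatialDeriv_eq_zero_of_isEntryPoint {ψ f : Pt → ℝ}
    (hsupp : D.supp ψ ∩ (D.Γminus ∪ D.Γzero) = ∅) (hψf : EqOn ψ f D.Ω) {a : Fin 3 → ℕ}
    (hf : Continuous (spatialDeriv a f)) {y : E3} {q : S2 × ℝ} (hq : q.2 ∈ Ioo D.E₀ D.E₁)
    (hy : IsEntryPoint D.G (q.1 : E3) y) : spatialDeriv a f (y, q) = 0 := by
  have hyψ : ((y, q) : Pt) ∉ D.supp ψ := fun h => eq_empty_iff_forall_notMem.mp hsupp _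
    ⟨h, mem_inflow_of_isEntryPoint hy (Ioo_subset_Icc_self hq)⟩
  have hline : Filter.Tendsto (fun t : ℝ => ((y + t • (q.1 : E3), q) : Pt))
      (nhdsWithin 0 (Ioi 0)) (nhds (y, q)) :=
    (tendsto_add_smul_nhdsGT _ y).prodMk_nhds tendsto_const_nhds
  refine tendsto_nhds_unique_of_eventuallyEq ((hf.tendsto _).comp hline) tendsto_const_nhds ?_
  filter_upwards [hy.2, hline.eventually (isClosed_closure.isOpen_compl.mem_nhds hyψ)]
    with t htG htψ
  have htΩ : ((y + t • (q.1 : E3), q) : Pt) ∈ D.Ω := ⟨htG, mem_univ _, hq⟩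
  rw [Function.comp_apply, ← spatialDeriv_congr hψf a htΩ, spatialDeriv,
    ((slice_eventuallyEq_zero htΩ htψ).iteratedFDeriv ℝ _).eq_of_nhds, iteratedFDeriv_zero]
  rfl

/-- The measure `dω dE` on `S × I°`. -/
noncomputable def angleEnergyMeasure (D : Domain) : Measure (S2 × ℝ) :=
  (((volume : Measure E3).toSphere).prod (volume : Measure ℝ)).restrict (univ ×ˢ Ioo D.E₀ D.E₁)

theorem μ_eq_prod (D : Domain) :
    D.μ = ((volume : Measure E3).restrict D.G).prod D.angleEnergyMeasure := by
  rw [μ, Ω, angleEnergyMeasure, Measure.prod_restrict]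

instance : IsFiniteMeasure ((volume : Measure E3).restrict D.G) :=
  isFiniteMeasure_restrict.mpr D.isBounded.measure_lt_top.ne

instance : IsFiniteMeasure D.angleEnergyMeasure := by
  refine isFiniteMeasure_restrict.mpr ?_
  rw [Measure.prod_prod]
  exact ENNReal.mul_ne_top (measure_ne_top _ _) (by simp)

instance : IsFiniteMeasure D.μ := by
  rw [μ_eq_prod]
  infer_instance

theorem integral_streaming_mul_nonneg {ψ f : Pt → ℝ}
    (hsupp : D.supp ψ ∩ (D.Γminus ∪ D.Γzero) = ∅) (hψf : EqOn ψ f D.Ω) {a : Fin 3 → ℕ}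
    (hf : IsCk0 (∑ i, a i + 1 : ℕ) f) :
    0 ≤ ∫ p, streaming (spatialDeriv a f) p * spatialDeriv a f p ∂D.μ := by
  have hcont : Continuous (spatialDeriv a f) := hf.continuous a (mod_cast Nat.le_succ _)
  have hcompact := hf.hasCompactSupport_spatialDeriv a
  have hstream : Continuous (streaming (spatialDeriv a f)) := by
    rw [← spatialDeriv_streaming hf.contDiff]
    exact hf.streaming.continuous a le_rfl
  have hint : Integrable (fun p => streaming (spatialDeriv a f) p * spatialDeriv a f p) D.μ :=
    ((hstream.mul hcont).integrable_of_hasCompactSupport hcompact.mul_left).integrableOn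
  rw [μ_eq_prod] at hint ⊢
  rw [integral_prod_symm _ hint]
  refine setIntegral_nonneg (MeasurableSet.univ.prod measurableSet_Ioo) fun q hq => ?_
  have hslice : ContDiff ℝ 1 fun x => spatialDeriv a f (x, q) :=
    (ContinuousMultilinearMap.apply ℝ (fun _ => E3) ℝ (multiDir a)).contDiff.comp
      ((hf.contDiff q).iteratedFDeriv_right (by exact_mod_cast (add_comm _ _).le))
  have hslice_compact : HasCompactSupport fun x => spatialDeriv a f (x, q) :=
    .of_support_subset_isCompact (hcompact.isCompact.image continuous_fst)
      fun x hx => ⟨(x, q), subset_tsupport _ hx, rfl⟩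
  exact setIntegral_fderiv_mul_self_nonneg D.isOpen D.isBounded.measure_lt_top.ne hslice
    hslice_compact fun y hy => spatialDeriv_eq_zero_of_isEntryPoint hsupp hψf hcont hq.2 hy

theorem supp_streaming_subset (ψ : Pt → ℝ) : D.supp (streaming ψ) ⊆ D.supp ψ := by
  refine closure_minimal (fun p hp => ?_) isClosed_closure
  by_contra hψ
  exact hp.2 (by simp [streaming, (slice_eventuallyEq_zero hp.1 hψ).fderiv_eq])

theorem streaming_mem_testSpace {ψ : Pt → ℝ} (hψ : ψ ∈ D.testSpace) :
    streaming ψ ∈ D.testSpace := by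
  intro k _
  obtain ⟨⟨f, hf, hψf⟩, hsupp⟩ := hψ (k + 1) (by lia)
  exact ⟨⟨streaming f, hf.streaming, streaming_congr hψf⟩,
    subset_empty_iff.mp (hsupp ▸ inter_subset_inter_left _ (supp_streaming_subset ψ))⟩

theorem mul_mem_testSpace {φ ψ : Pt → ℝ} (hφ : φ ∈ D.smoothSpace) (hψ : ψ ∈ D.testSpace) :
    φ * ψ ∈ D.testSpace := by
  intro k hk
  obtain ⟨⟨f, hf, hψf⟩, hsupp⟩ := hψ k hk
  obtain ⟨g, hg, hφg⟩ := hφ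
  refine ⟨⟨g * f, (hg.of_le le_top).mul hf, fun p hp => by simp [hψf hp, hφg hp]⟩, ?_⟩
  have hsub : D.supp (φ * ψ) ⊆ D.supp ψ :=
    closure_mono (inter_subset_inter_right _ (Function.support_mul_subset_right φ ψ))
  exact subset_empty_iff.mp (hsupp ▸ inter_subset_inter_left _ hsub)

theorem coeFn_jet2 (m : ℕ) (ψ : D.testSpace) (α : MultiIndex m) :
    D.jet2 m ψ α =ᵐ[D.μ] spatialDeriv α.exps ψ :=
  MemLp.coeFn_toLp ((isCkBar_of_mem_testSpace ψ.2 m).memLp 2 α.sum_exps_le)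

/-- The test function `ω · ∇ₓ ψ`. -/
noncomputable def streamingTest (ψ : D.testSpace) : D.testSpace :=
  ⟨streaming ψ, streaming_mem_testSpace ψ.2⟩

theorem inner_streamingTest_nonneg (m : ℕ) (ψ : D.testSpace) :
    0 ≤ inner ℝ (D.toH0 m (streamingTest ψ)) (D.toH0 m ψ) := by
  change 0 ≤ inner ℝ (D.jet2 m (streamingTest ψ)) (D.jet2 m ψ)
  rw [PiLp.inner_apply]
  refine Finset.sum_nonneg fun α _ => ?_
  obtain ⟨⟨f, hf, hψf⟩, hsupp⟩ := ψ.2 (∑ i, α.exps i + 1) (by lia)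
  rw [L2.inner_def]
  refine (integral_streaming_mul_nonneg hsupp hψf hf).trans_eq (integral_congr_ae ?_)
  filter_upwards [coeFn_jet2 m (streamingTest ψ) α, coeFn_jet2 m ψ α,
    ae_eq_of_eqOn (spatialDeriv_congr hψf α.exps),
    ae_eq_of_eqOn (spatialDeriv_congr (streaming_congr hψf) α.exps)] with p hstream hψ hf₁ hf₂
  rw [hstream, hψ, streamingTest, hf₁, hf₂, spatialDeriv_streaming hf.contDiff, mul_comm]
  rfl

end Domain

theorem ae_eq_zero_of_forall_setIntegral_prod {X Y E : Type*} [MeasurableSpace X]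
    [MeasurableSpace Y] [NormedAddCommGroup E] [NormedSpace ℝ E] [CompleteSpace E]
    {μ : Measure (X × Y)} {g : X × Y → E} (hg : Integrable g μ)
    (hrect : ∀ A B, MeasurableSet A → MeasurableSet B → ∫ p in A ×ˢ B, g p ∂μ = 0) :
    g =ᵐ[μ] 0 := by
  have huniv : ∫ p, g p ∂μ = 0 := by
    simpa only [univ_prod_univ, setIntegral_univ] using hrect univ univ .univ .univ
  suffices hzero : ∀ s, MeasurableSet s → ∫ p in s, g p ∂μ = 0 from
    hg.ae_eq_zero_of_forall_setIntegral_eq_zero fun s hs _ => hzero s hs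
  intro s hs
  induction s, hs using MeasurableSpace.induction_on_inter generateFrom_prod.symm
    isPiSystem_prod with
  | empty => exact setIntegral_empty
  | basic t ht =>
    obtain ⟨A, hA, B, hB, rfl⟩ := ht
    exact hrect A B hA hB
  | compl t ht ih => simpa only [ih, zero_add, huniv] using integral_add_compl ht hg
  | iUnion t hd ht ih =>
    rw [integral_iUnion ht hd hg.integrableOn]
    simp only [ih, tsum_zero]

section WeakDerivative

variable {E : Type*} [NormedAddCommGroup E] [NormedSpace ℝ E]

/-- `χ` is a test function in the sense of distributions on the set `G`. -/
structure IsTestFunction (G : Set E) (χ : E → ℝ) : Prop where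
  contDiff : ContDiff ℝ ∞ χ
  hasCompactSupport : HasCompactSupport χ
  tsupport_subset : tsupport χ ⊆ G

theorem IsTestFunction.fderiv_apply {G : Set E} {χ : E → ℝ} (hχ : IsTestFunction G χ) (w : E) :
    IsTestFunction G fun x => fderiv ℝ χ x w where
  contDiff := (contDiff_infty_iff_fderiv.mp hχ.contDiff).2.clm_apply contDiff_const
  hasCompactSupport := hχ.hasCompactSupport.fderiv_apply ℝ w
  tsupport_subset := (tsupport_fderiv_apply_subset ℝ w).trans hχ.tsupport_subset

theorem IsTestFunction.neg {G : Set E} {χ : E → ℝ} (hχ : IsTestFunction G χ) :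
    IsTestFunction G (-χ) where
  contDiff := hχ.contDiff.neg
  hasCompactSupport := hχ.hasCompactSupport.neg
  tsupport_subset := by rw [tsupport, Function.support_neg]; exact hχ.tsupport_subset

variable [MeasurableSpace E]

theorem IsTestFunction.setIntegral_mul {μ : Measure E} {G : Set E} {χ : E → ℝ}
    (hχ : IsTestFunction G χ) (k : E → ℝ) : ∫ x in G, χ x * k x ∂μ = ∫ x, χ x * k x ∂μ :=
  setIntegral_eq_integral_of_forall_compl_eq_zero fun x hx => by
    rw [image_eq_zero_of_notMem_tsupport fun h => hx (hχ.tsupport_subset h), zero_mul]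

variable [BorelSpace E] {Y : Type*} [MeasurableSpace Y]

theorem IsTestFunction.memLp_indicator {μ : Measure (E × Y)} [IsFiniteMeasure μ] {G : Set E}
    {χ : E → ℝ} (hχ : IsTestFunction G χ) (p : ℝ≥0∞) {S : Set (E × Y)} (hS : MeasurableSet S) :
    MemLp (S.indicator fun z => χ z.1) p μ := by
  obtain ⟨M, hM⟩ := hχ.hasCompactSupport.exists_bound_of_continuous hχ.contDiff.continuous
  exact (MemLp.of_bound (hχ.contDiff.continuous.measurable.comp
    measurable_fst).aestronglyMeasurable M (.of_forall fun z => hM z.1)).indicator hS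

theorem IsTestFunction.integrable_mul {μ : Measure (E × Y)} {G : Set E} {χ : E → ℝ}
    (hχ : IsTestFunction G χ) {g : E × Y → ℝ} (hg : Integrable g μ) :
    Integrable (fun p => χ p.1 * g p) μ := by
  obtain ⟨M, hM⟩ := hχ.hasCompactSupport.exists_bound_of_continuous hχ.contDiff.continuous
  exact hg.bdd_mul (hχ.contDiff.continuous.measurable.comp measurable_fst).aestronglyMeasurable
    (.of_forall fun p => hM p.1)

theorem IsTestFunction.setIntegral_prod_mul {μ : Measure E} [SFinite μ] {ν : Measure Y}
    [SFinite ν] {G : Set E} {χ : E → ℝ} (hχ : IsTestFunction G χ) {g : E × Y → ℝ}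
    (hg : Integrable g ((μ.restrict G).prod ν)) (B : Set Y) :
    ∫ p in univ ×ˢ B, χ p.1 * g p ∂(μ.restrict G).prod ν =
      ∫ y in B, ∫ x, χ x * g (x, y) ∂μ ∂ν := by
  have hint := (hχ.integrable_mul hg).integrableOn (s := univ ×ˢ B)
  rw [IntegrableOn, ← Measure.prod_restrict, Measure.restrict_univ] at hint
  rw [← Measure.prod_restrict, Measure.restrict_univ, integral_prod_symm _ hint]
  simp only [hχ.setIntegral_mul]

variable [FiniteDimensional ℝ E] {μ : Measure E}

theorem ae_eq_zero_of_forall_setIntegral_isTestFunction [SFinite μ]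
    {ν : Measure Y} [SFinite ν] {G : Set E} (hG : IsOpen G) {g : E × Y → ℝ}
    (hg : Integrable g ((μ.restrict G).prod ν))
    (horth : ∀ χ, IsTestFunction G χ → ∀ B, MeasurableSet B →
      ∫ p in univ ×ˢ B, χ p.1 * g p ∂(μ.restrict G).prod ν = 0) :
    g =ᵐ[(μ.restrict G).prod ν] 0 := by
  refine ae_eq_zero_of_forall_setIntegral_prod hg fun A B _ hB => ?_
  let k : E → ℝ := fun x => ∫ y in B, g (x, y) ∂ν
  have hk : IntegrableOn k G μ := by
    have hgB := hg.integrableOn (s := univ ×ˢ B)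
    rw [IntegrableOn, ← Measure.prod_restrict, Measure.restrict_univ] at hgB
    exact hgB.integral_prod_left
  have hk0 : ∀ᵐ x ∂μ, x ∈ G → k x = 0 := by
    refine hG.ae_eq_zero_of_integral_contDiff_smul_eq_zero hk.locallyIntegrableOn
      fun χ hχ hc hs => ?_
    have hχG : IsTestFunction G χ := ⟨hχ, hc, hs⟩
    calc ∫ x, χ x • k x ∂μ = ∫ x in G, χ x * k x ∂μ :=
          (hχG.setIntegral_mul k).symm
      _ = ∫ p in univ ×ˢ B, χ p.1 * g p ∂(μ.restrict G).prod ν := by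
          rw [setIntegral_prod _ (hχG.integrable_mul hg).integrableOn, setIntegral_univ]
          simp only [k, integral_const_mul]
      _ = 0 := horth χ hχG B hB
  rw [setIntegral_prod _ hg.integrableOn]
  exact integral_eq_zero_of_ae (ae_restrict_of_ae ((ae_restrict_iff' hG.measurableSet).mpr hk0))

theorem exists_isTestFunction_integral_iteratedFDeriv_eq [μ.IsAddHaarMeasure] {G : Set E} {n : ℕ}
    (v : Fin n → E) {χ : E → ℝ} (hχ : IsTestFunction G χ) :
    ∃ χ', IsTestFunction G χ' ∧ ∀ f : E → ℝ, ContDiff ℝ n f →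
      ∫ x, χ x * iteratedFDeriv ℝ n f x v ∂μ = ∫ x, χ' x * f x ∂μ := by
  induction n generalizing χ with
  | zero => exact ⟨χ, hχ, fun f _ => by simp only [iteratedFDeriv_zero_apply]⟩
  | succ n ih =>
    obtain ⟨χ', hχ', hparts⟩ := ih (Fin.tail v) (hχ.fderiv_apply (v 0)).neg
    refine ⟨χ', hχ', fun f hf => ?_⟩
    let u : E → ℝ := fun x => iteratedFDeriv ℝ n f x (Fin.tail v)
    have hu : ContDiff ℝ 1 u :=
      (ContinuousMultilinearMap.apply ℝ (fun _ => E) ℝ (Fin.tail v)).contDiff.comp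
        (hf.iteratedFDeriv_right (by exact_mod_cast (add_comm _ _).le))
    have hsucc (x : E) : iteratedFDeriv ℝ (n + 1) f x v = fderiv ℝ u x (v 0) :=
      (hf.differentiable_iteratedFDeriv (mod_cast n.lt_succ_self) x).iteratedFDeriv_succ_apply_left'
    have hχc := hχ.contDiff.continuous
    have hχ'c := (hχ.fderiv_apply (v 0)).contDiff.continuous
    have hu'c : Continuous fun x => fderiv ℝ u x (v 0) :=
      (hu.continuous_fderiv one_ne_zero).clm_apply continuous_const
    simp only [hsucc]
    rw [integral_mul_fderiv_eq_neg_fderiv_mul_of_integrable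
      ((hχ'c.mul hu.continuous).integrable_of_hasCompactSupport
        (hχ.fderiv_apply (v 0)).hasCompactSupport.mul_right)
      ((hχc.mul hu'c).integrable_of_hasCompactSupport hχ.hasCompactSupport.mul_right)
      ((hχc.mul hu.continuous).integrable_of_hasCompactSupport hχ.hasCompactSupport.mul_right)
      (fun x _ => hχ.contDiff.differentiable (by norm_num) x)
      (fun x _ => hu.differentiable one_ne_zero x), ← hparts f (hf.of_le (mod_cast n.le_succ)),
      ← integral_neg]
    simp only [Pi.neg_apply, neg_mul, u]

end WeakDerivative

theorem inner_toLp_indicator {X : Type*} [MeasurableSpace X] {μ : Measure X} {S : Set X}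
    (hS : MeasurableSet S) {g : X → ℝ} (hg : MemLp (S.indicator g) 2 μ) (u : Lp ℝ 2 μ) :
    inner ℝ (hg.toLp _) u = ∫ x in S, g x * u x ∂μ := by
  rw [L2.inner_def, ← integral_indicator hS]
  refine integral_congr_ae ?_
  filter_upwards [hg.coeFn_toLp] with x hx
  rw [hx, RCLike.inner_apply, conj_trivial, mul_comm]
  exact (indicator_mul_left S g u).symm

namespace Domain

variable {D : Domain}

theorem exists_isTestFunction_setIntegral_spatialDeriv_eq (a : Fin 3 → ℕ) {χ : E3 → ℝ}
    (hχ : IsTestFunction D.G χ) :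
    ∃ χ', IsTestFunction D.G χ' ∧ ∀ (B : Set (S2 × ℝ)) {k : ℕ} {f : Pt → ℝ}, IsCk0 k f →
      ∑ i, a i ≤ k →
      ∫ p in univ ×ˢ B, χ p.1 * spatialDeriv a f p ∂D.μ = ∫ p in univ ×ˢ B, χ' p.1 * f p ∂D.μ := by
  obtain ⟨χ', hχ', hparts⟩ :=
    exists_isTestFunction_integral_iteratedFDeriv_eq (μ := volume) (multiDir a) hχ
  refine ⟨χ', hχ', fun B k f hf ha => ?_⟩
  have hint {b : Fin 3 → ℕ} (hb : ∑ i, b i ≤ k) : Integrable (spatialDeriv b f) D.μ :=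
    ((hf.continuous b (mod_cast hb)).integrable_of_hasCompactSupport
      (hf.hasCompactSupport_spatialDeriv b)).integrableOn
  have hint₀ : Integrable f D.μ := spatialDeriv_zero f ▸ hint (b := 0) (by simp)
  specialize hint ha
  rw [μ_eq_prod] at hint hint₀ ⊢
  rw [hχ.setIntegral_prod_mul hint, hχ'.setIntegral_prod_mul hint₀]
  exact integral_congr_ae (.of_forall fun q =>
    hparts _ ((hf.contDiff q).of_le (mod_cast ha)))

theorem exists_isTestFunction_setIntegral_jet2_eq {m : ℕ} (α : MultiIndex m) {χ : E3 → ℝ}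
    (hχ : IsTestFunction D.G χ) :
    ∃ χ', IsTestFunction D.G χ' ∧ ∀ (B : Set (S2 × ℝ)) (ψ : D.testSpace),
      ∫ p in univ ×ˢ B, χ p.1 * D.jet2 m ψ α p ∂D.μ =
        ∫ p in univ ×ˢ B, χ' p.1 * D.jet2 m ψ (MultiIndex.zero m) p ∂D.μ := by
  obtain ⟨χ', hχ', hparts⟩ := exists_isTestFunction_setIntegral_spatialDeriv_eq α.exps hχ
  refine ⟨χ', hχ', fun B ψ => ?_⟩
  obtain ⟨⟨f, hf, hψf⟩, -⟩ := ψ.2 (m + 1) (by lia)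
  have hjet (β : MultiIndex m) (g : E3 → ℝ) :
      ∫ p in univ ×ˢ B, g p.1 * D.jet2 m ψ β p ∂D.μ =
        ∫ p in univ ×ˢ B, g p.1 * spatialDeriv β.exps f p ∂D.μ := by
    refine integral_congr_ae (ae_restrict_of_ae ?_)
    filter_upwards [coeFn_jet2 m ψ β, ae_eq_of_eqOn (spatialDeriv_congr hψf β.exps)] with p h₁ h₂
    rw [h₁, h₂]
  rw [hjet, hjet, hparts B hf (mod_cast α.sum_exps_le)]
  exact congrArg (fun g => ∫ p in univ ×ˢ B, χ' p.1 * g p ∂D.μ) (spatialDeriv_zero f).symm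

theorem ae_eq_zero_of_setIntegral_isTestFunction_eq_zero {g : Pt → ℝ} (hg : Integrable g D.μ)
    (horth : ∀ χ, IsTestFunction D.G χ → ∀ B, MeasurableSet B →
      ∫ p in univ ×ˢ B, χ p.1 * g p ∂D.μ = 0) : g =ᵐ[D.μ] 0 := by
  rw [μ_eq_prod] at *
  exact ae_eq_zero_of_forall_setIntegral_isTestFunction D.isOpen hg horth

-- The weak derivative identity `∫ χ ∂ₓ^α ψ = ∫ χ' ψ` passes to the completion, so an element of
-- `H₀^{(m,0,0)}` is determined by its component `α = 0`.
theorem H0.fn_injective {m : ℕ} : Function.Injective (H0.fn : D.H0 m → Lp ℝ 2 D.μ) := by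
  suffices hzero : ∀ u : D.H0 m, H0.fn u = 0 → u = 0 from fun u v huv =>
    sub_eq_zero.mp (hzero (u - v) (sub_eq_zero.mpr huv))
  intro u hu
  ext α : 2
  refine Lp.eq_zero_iff_ae_eq_zero.mpr (ae_eq_zero_of_setIntegral_isTestFunction_eq_zero
    ((Lp.memLp _).integrable one_le_two) fun χ hχ B hB => ?_)
  obtain ⟨χ', hχ', hparts⟩ := exists_isTestFunction_setIntegral_jet2_eq α hχ
  have hS : MeasurableSet ((univ : Set E3) ×ˢ B) := MeasurableSet.univ.prod hB
  let b := (hχ.memLp_indicator 2 hS : MemLp _ 2 D.μ).toLp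
  let b' := (hχ'.memLp_indicator 2 hS : MemLp _ 2 D.μ).toLp
  have hclosed : IsClosed {w : D.Jet2 m | inner ℝ b (w α) = inner ℝ b' (w (MultiIndex.zero m))} :=
    isClosed_eq (continuous_const.inner (PiLp.continuous_apply 2 _ α))
      (continuous_const.inner (PiLp.continuous_apply 2 _ _))
  have hjet : inner ℝ b ((u : D.Jet2 m) α) = inner ℝ b' (H0.fn u) := by
    refine closure_minimal ?_ hclosed u.2
    rintro _ ⟨ψ, rfl⟩
    simpa only [mem_ofPred_eq, b, b', inner_toLp_indicator hS] using hparts B ψ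
  rwa [hu, inner_zero_right, inner_toLp_indicator hS] at hjet

end Domain

section CompletionMaps

theorem piLp_norm_le_sum_norm {ι : Type*} [Fintype ι] {E : ι → Type*}
    [∀ i, SeminormedAddCommGroup (E i)] (x : PiLp 2 E) : ‖x‖ ≤ ∑ i, ‖x i‖ := by
  refine le_of_sq_le_sq ?_ (Finset.sum_nonneg fun i _ => norm_nonneg (x i))
  rw [PiLp.norm_sq_eq_of_L2]
  exact Finset.sum_sq_le_sq_sum_of_nonneg fun i _ => norm_nonneg (x i)

theorem ae_norm_le_norm {X E : Type*} [MeasurableSpace X] {μ : Measure X} [NormedAddCommGroup E]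
    (s : Lp E ∞ μ) : ∀ᵐ x ∂μ, ‖s x‖ ≤ ‖s‖ := by
  filter_upwards [enorm_ae_le_eLpNormEssSup s μ] with x hx
  rwa [← eLpNorm_exponent_top, ← Lp.enorm_def, enorm_le_iff_norm_le] at hx

theorem denseRange_codRestrict_topologicalClosure {R V F : Type*} [Semiring R] [AddCommMonoid V]
    [Module R V] [TopologicalSpace F] [AddCommMonoid F] [ContinuousAdd F] [Module R F]
    [ContinuousConstSMul R F] (f : V →ₗ[R] F)
    (hf : ∀ v, f v ∈ (LinearMap.range f).topologicalClosure) :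
    DenseRange (f.codRestrict (LinearMap.range f).topologicalClosure hf) := by
  refine Subtype.dense_iff.mpr ?_
  rw [← range_comp]
  exact subset_rfl

end CompletionMaps

theorem MultiIndex.exists_exps_eq {m : ℕ} {a : Fin 3 → ℕ} (ha : ∑ i, a i ≤ m) :
    ∃ α : MultiIndex m, α.exps = a :=
  ⟨⟨fun i => ⟨a i, Nat.lt_succ_of_le
    ((Finset.single_le_sum (fun _ _ => Nat.zero_le _) (Finset.mem_univ i)).trans ha)⟩, ha⟩, rfl⟩

/-- A constant for which `Domain.ProductBound m` holds on every domain: `6 ^ m` bounds the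
coefficients of the Leibniz rule, and the two further factors compare the `ℓ²` norm of a family
indexed by `MultiIndex m` with sums of norms. -/
noncomputable def productConst (m : ℕ) : ℝ :=
  Fintype.card (MultiIndex m) * (6 ^ m * Fintype.card (MultiIndex m))

theorem productConst_pos (m : ℕ) : 0 < productConst m := by
  have hcard : (0 : ℝ) < Fintype.card (MultiIndex m) :=
    mod_cast Fintype.card_pos_iff.mpr ⟨MultiIndex.zero m⟩
  unfold productConst
  positivity

namespace Domain

variable {D : Domain} {m : ℕ}

theorem denseRange_toH0 : DenseRange (D.toH0 m) :=
  denseRange_codRestrict_topologicalClosure _ _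

variable (D m) in
/-- A function of class `C^{(∞,0,0)}` as an element of `𝒲^{∞,(m,0,0)}(G × S × I)`. -/
noncomputable def toW : D.smoothSpace →ₗ[ℝ] D.W m :=
  (D.jetInf m).codRestrict (D.W m) fun φ =>
    Submodule.le_topologicalClosure _ (LinearMap.mem_range_self _ φ)

theorem denseRange_toW : DenseRange (D.toW m) :=
  denseRange_codRestrict_topologicalClosure _ _

/-- Multiplication of functions of class `C^{(∞,0,0)}` by a fixed test function. -/
def mulTest (ψ : D.testSpace) : D.smoothSpace →ₗ[ℝ] D.testSpace where
  toFun φ := ⟨(φ : Pt → ℝ) * ψ, mul_mem_testSpace φ.2 ψ.2⟩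
  map_add' φ φ' := Subtype.ext (add_mul (φ : Pt → ℝ) φ' ψ)
  map_smul' c φ := Subtype.ext (smul_mul_assoc c (φ : Pt → ℝ) ψ)

theorem coeFn_jetInf (φ : D.smoothSpace) (α : MultiIndex m) :
    D.jetInf m φ α =ᵐ[D.μ] spatialDeriv α.exps φ :=
  MemLp.coeFn_toLp (IsCkBar.memLp φ.2 ∞ le_top)

theorem abs_spatialDeriv_mul_le_of_mem {φ ψ : Pt → ℝ} (hφ : φ ∈ D.smoothSpace)
    (hψ : ψ ∈ D.testSpace) {p : Pt} (hp : p ∈ D.Ω) {M N : ℝ}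
    (hM : ∀ β : MultiIndex m, |spatialDeriv β.exps φ p| ≤ M)
    (hN : ∀ β : MultiIndex m, |spatialDeriv β.exps ψ p| ≤ N) (α : MultiIndex m) :
    |spatialDeriv α.exps (φ * ψ) p| ≤ 6 ^ m * (M * N) := by
  obtain ⟨g, hg, hφg⟩ := hφ
  obtain ⟨⟨f, hf, hψf⟩, -⟩ := hψ (m + 1) (by lia)
  have hα : ∑ i, α.exps i ≤ m := α.2
  have hprod : EqOn (φ * ψ) (g * f) D.Ω := fun p hp => by simp [hφg hp, hψf hp]
  have hM0 : 0 ≤ M := (abs_nonneg _).trans (hM (MultiIndex.zero m))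
  have hN0 : 0 ≤ N := (abs_nonneg _).trans (hN (MultiIndex.zero m))
  rw [spatialDeriv_congr hprod _ hp]
  refine (abs_spatialDeriv_mul_le (M := M) (N := N)
    (fun q => (hg.contDiff q).of_le (mod_cast le_top))
    (fun q => (hf.contDiff q).of_le (mod_cast hα.trans (Nat.le_succ m)))
    (fun b hb => ?_) fun b hb => ?_).trans (by gcongr; norm_num)
  · obtain ⟨β, rfl⟩ := MultiIndex.exists_exps_eq (hb.trans hα)
    exact spatialDeriv_congr hφg _ hp ▸ hM β
  · obtain ⟨β, rfl⟩ := MultiIndex.exists_exps_eq (hb.trans hα)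
    exact spatialDeriv_congr hψf _ hp ▸ hN β

theorem norm_jet2_mulTest_apply_le (ψ : D.testSpace) (φ : D.smoothSpace) (α : MultiIndex m) :
    ‖D.jet2 m (mulTest ψ φ) α‖ ≤ 6 ^ m * ‖D.jetInf m φ‖ * ‖∑ β, |D.jet2 m ψ β|‖ := by
  refine Lp.norm_le_mul_norm_of_ae_le_mul ?_
  filter_upwards [coeFn_jet2 m (mulTest ψ φ) α, ae_restrict_mem measurableSet_Ω,
    Lp.coeFn_fun_finsetSum Finset.univ fun β => |D.jet2 m ψ β|,
    ae_all_iff.mpr fun β => coeFn_jet2 m ψ β, ae_all_iff.mpr fun β => Lp.coeFn_abs (D.jet2 m ψ β),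
    ae_all_iff.mpr fun β => coeFn_jetInf (m := m) φ β,
    ae_all_iff.mpr fun β => ae_norm_le_norm (D.jetInf m φ β)]
    with p hprod hp hsum hψ habs hφ hφ_le
  simp only [habs, hψ] at hsum
  rw [hprod, hsum, Real.norm_of_nonneg (Finset.sum_nonneg fun _ _ => abs_nonneg _), mul_assoc]
  refine abs_spatialDeriv_mul_le_of_mem φ.2 ψ.2 hp (fun β => ?_)
    (fun β => Finset.single_le_sum (f := fun β : MultiIndex m => |spatialDeriv β.exps ψ p|)
      (fun _ _ => abs_nonneg _) (Finset.mem_univ β)) α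
  rw [← hφ, ← Real.norm_eq_abs]
  exact (hφ_le β).trans (norm_le_pi_norm _ β)

theorem norm_toH0_mulTest_le (ψ : D.testSpace) (φ : D.smoothSpace) :
    ‖D.toH0 m (mulTest ψ φ)‖ ≤ productConst m * ‖D.toH0 m ψ‖ * ‖D.toW m φ‖ := by
  change ‖D.jet2 m (mulTest ψ φ)‖ ≤ productConst m * ‖D.jet2 m ψ‖ * ‖D.jetInf m φ‖
  have hsum : ‖∑ β, |D.jet2 m ψ β|‖ ≤ Fintype.card (MultiIndex m) * ‖D.jet2 m ψ‖ :=
    (norm_sum_le_of_le _ fun β _ =>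
      (norm_abs_eq_norm _).trans_le (PiLp.norm_apply_le (D.jet2 m ψ) β)).trans_eq (by simp)
  calc ‖D.jet2 m (mulTest ψ φ)‖
      ≤ ∑ α, ‖D.jet2 m (mulTest ψ φ) α‖ := piLp_norm_le_sum_norm _
    _ ≤ ∑ _α : MultiIndex m, 6 ^ m * ‖D.jetInf m φ‖ *
          (Fintype.card (MultiIndex m) * ‖D.jet2 m ψ‖) :=
        Finset.sum_le_sum fun α _ => (norm_jet2_mulTest_apply_le ψ φ α).trans (by gcongr)
    _ = productConst m * ‖D.jet2 m ψ‖ * ‖D.jetInf m φ‖ := by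
        rw [Finset.sum_const, Finset.card_univ, nsmul_eq_mul, productConst]
        ring

instance : CompleteSpace (D.H0 m) :=
  inferInstanceAs (CompleteSpace (LinearMap.range (D.jet2 m)).topologicalClosure)

variable (m) in
/-- Multiplication of elements of `𝒲^{∞,(m,0,0)}(G × S × I)` by a fixed test function, as a bounded
operator into `H₀^{(m,0,0)}(G × S × I, Γ₋)`. -/
noncomputable def mulH0 (ψ : D.testSpace) : D.W m →L[ℝ] D.H0 m :=
  (D.toH0 m ∘ₗ mulTest ψ).extendOfNorm (D.toW m)

theorem mulH0_toW (ψ : D.testSpace) (φ : D.smoothSpace) :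
    mulH0 m ψ (D.toW m φ) = D.toH0 m (mulTest ψ φ) :=
  LinearMap.extendOfNorm_eq (f := D.toH0 m ∘ₗ mulTest ψ) (e := D.toW m) denseRange_toW
    ⟨_, norm_toH0_mulTest_le ψ⟩ φ

theorem norm_mulH0_apply_le (ψ : D.testSpace) (σ : D.W m) :
    ‖mulH0 m ψ σ‖ ≤ productConst m * ‖D.toH0 m ψ‖ * ‖σ‖ :=
  LinearMap.norm_extendOfNorm_apply_le (f := D.toH0 m ∘ₗ mulTest ψ) (e := D.toW m) denseRange_toW
    _ (norm_toH0_mulTest_le ψ) σ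

theorem coeFn_fn_toH0 (ψ : D.testSpace) : H0.fn (D.toH0 m ψ) =ᵐ[D.μ] ψ :=
  (coeFn_jet2 m ψ (MultiIndex.zero m)).trans (.of_eq (spatialDeriv_zero ψ))

theorem coeFn_fn_toW (φ : D.smoothSpace) : W.fn (D.toW m φ) =ᵐ[D.μ] φ :=
  (coeFn_jetInf φ (MultiIndex.zero m)).trans (.of_eq (spatialDeriv_zero φ))

theorem H0.continuous_fn : Continuous (H0.fn : D.H0 m → Lp ℝ 2 D.μ) :=
  (PiLp.continuous_apply 2 _ _).comp continuous_subtype_val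

theorem W.continuous_fn : Continuous (W.fn : D.W m → Lp ℝ ∞ D.μ) :=
  (continuous_apply _).comp continuous_subtype_val

theorem isProduct_mulH0 (σ : D.W m) (ψ : D.testSpace) : IsProduct σ ψ (mulH0 m ψ σ) := by
  let mulLp := (ContinuousLinearMap.mul ℝ ℝ).holderL D.μ ∞ 2 2
  have hmulLp (s : Lp ℝ ∞ D.μ) :
      mulLp s (H0.fn (D.toH0 m ψ)) =ᵐ[D.μ] fun p => s p * (ψ : Pt → ℝ) p := by
    filter_upwards [(ContinuousLinearMap.mul ℝ ℝ).coeFn_holder (r := 2) s (H0.fn (D.toH0 m ψ)),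
      coeFn_fn_toH0 (m := m) ψ] with p hholder hψ
    exact hholder.trans (congrArg (s p * ·) hψ)
  suffices heq : H0.fn ∘ mulH0 m ψ = fun σ => mulLp (W.fn σ) (H0.fn (D.toH0 m ψ)) by
    rw [IsProduct, ← Function.comp_apply (f := H0.fn), heq]
    exact hmulLp _
  refine denseRange_toW.equalizer (H0.continuous_fn.comp (mulH0 m ψ).continuous)
    ((mulLp.continuous.comp W.continuous_fn).clm_apply continuous_const) (funext fun φ => Lp.ext ?_)
  simp only [Function.comp_apply, mulH0_toW]
  filter_upwards [coeFn_fn_toH0 (m := m) (mulTest ψ φ), coeFn_fn_toW (m := m) φ,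
    hmulLp (W.fn (D.toW m φ))] with p hprod hφ hmul
  rw [hprod, hmul, hφ]
  rfl

theorem isProduct_iff {σ : D.W m} {ψ : D.testSpace} {w : D.H0 m} :
    IsProduct σ ψ w ↔ w = mulH0 m ψ σ :=
  ⟨fun hw => H0.fn_injective (Lp.ext (hw.trans (isProduct_mulH0 σ ψ).symm)),
    fun hw => hw ▸ isProduct_mulH0 σ ψ⟩

theorem productBound_productConst (D : Domain) (m : ℕ) : D.ProductBound m (productConst m) := by
  rintro σ ψ w hw
  rw [isProduct_iff.mp hw, mul_right_comm]
  exact norm_mulH0_apply_le ψ σ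

end Domain

section Quasiaccretive

variable {H : Type*} [NormedAddCommGroup H] [InnerProductSpace ℝ H]

/-- A linear relation `g` in a real inner product space, thought of as the graph of an unbounded
operator, is quasi-accretive with constant `κ` if adding `κ • id` makes it accretive. -/
def IsQuasiaccretive (g : Submodule ℝ (H × H)) (κ : ℝ) : Prop :=
  ∀ z ∈ g, -κ * ‖z.1‖ ^ 2 ≤ inner ℝ z.2 z.1

namespace IsQuasiaccretive

variable {g : Submodule ℝ (H × H)} {A : H →ₗ.[ℝ] H} {κ : ℝ}

theorem topologicalClosure (hg : IsQuasiaccretive g κ) :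
    IsQuasiaccretive g.topologicalClosure κ := fun _ hz =>
  closure_minimal (t := {z : H × H | -κ * ‖z.1‖ ^ 2 ≤ inner ℝ z.2 z.1}) hg
    (isClosed_le (by fun_prop) (by fun_prop)) hz

theorem snd_eq_zero (hg : IsQuasiaccretive g κ) (hd : Dense (Prod.fst '' (g : Set (H × H))))
    {z : H × H} (hz : z ∈ g) (h0 : z.1 = 0) : z.2 = 0 := by
  refine hd.eq_zero_of_inner_left ℝ ?_
  rintro _ ⟨y, hy, rfl⟩
  -- Quasi-accretivity of `z + t • y` for all real `t` leaves no room for a linear term in `t`.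
  have hquad (t : ℝ) : 0 ≤ (inner ℝ y.2 y.1 + κ * ‖y.1‖ ^ 2) * (t * t) +
      inner ℝ z.2 y.1 * t + 0 := by
    have hzy := hg _ (g.add_mem hz (g.smul_mem t hy))
    simp only [Prod.fst_add, Prod.snd_add, Prod.smul_fst, Prod.smul_snd, h0, zero_add,
      inner_add_left, real_inner_smul_left, real_inner_smul_right, norm_smul, mul_pow,
      Real.norm_eq_abs, sq_abs] at hzy
    linarith
  have hdiscrim := discrim_le_zero hquad
  rw [discrim, mul_zero, sub_zero] at hdiscrim
  exact pow_eq_zero_iff two_ne_zero |>.mp (hdiscrim.antisymm (sq_nonneg _))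

theorem isClosable (hA : IsQuasiaccretive A.graph κ) (hd : Dense (A.domain : Set H)) :
    A.IsClosable := by
  refine ⟨A.graph.topologicalClosure.toLinearPMap, (Submodule.toLinearPMap_graph_eq _ ?_).symm⟩
  refine fun z hz => hA.topologicalClosure.snd_eq_zero (hd.mono ?_) hz
  exact fun u hu => ⟨_, A.graph.le_topologicalClosure (A.mem_graph ⟨u, hu⟩), rfl⟩

theorem closure (hA : IsQuasiaccretive A.graph κ) (hd : Dense (A.domain : Set H)) :
    IsQuasiaccretive A.closure.graph κ := by
  rw [← (hA.isClosable hd).graph_closure_eq_closure_graph]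
  exact hA.topologicalClosure

theorem le_inner_add_smul (hA : IsQuasiaccretive A.graph κ) (C : ℝ) (u : A.domain) :
    (C - κ) * ‖(u : H)‖ ^ 2 ≤ inner ℝ (A u + C • (u : H)) (u : H) := by
  have hu := hA _ (A.mem_graph u)
  rw [inner_add_left, real_inner_smul_left, real_inner_self_eq_norm_sq]
  linarith

theorem isAccretive_smul_id_vadd (hA : IsQuasiaccretive A.graph κ) {C : ℝ} (hC : κ ≤ C) :
    IsAccretive ((C • (LinearMap.id : H →ₗ[ℝ] H)) +ᵥ A) := by
  intro u
  rw [LinearPMap.vadd_apply, add_comm]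
  exact (mul_nonneg (sub_nonneg.mpr hC) (sq_nonneg _)).trans (hA.le_inner_add_smul C u)

end IsQuasiaccretive

end Quasiaccretive

namespace Domain

variable {D : Domain} {m : ℕ}

theorem isTransportImage_iff {σ : D.W m} {ψ : D.testSpace} {f : D.H0 m} :
    IsTransportImage σ ψ f ↔ f = D.toH0 m (streamingTest ψ) + mulH0 m ψ σ := by
  have hself : IsTransportImage σ ψ (D.toH0 m (streamingTest ψ) + mulH0 m ψ σ) := by
    filter_upwards [Lp.coeFn_add (H0.fn (D.toH0 m (streamingTest ψ))) (H0.fn (mulH0 m ψ σ)),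
      coeFn_fn_toH0 (m := m) (streamingTest ψ), isProduct_mulH0 σ ψ] with p hadd hstream hmul
    exact hadd.trans (congrArg₂ (· + ·) hstream hmul)
  exact ⟨fun hf => H0.fn_injective (Lp.ext (hf.trans hself.symm)), fun hf => hf ▸ hself⟩

theorem isQuasiaccretive_transportGraph {c : ℝ} (hc : D.ProductBound m c) (σ : D.W m) :
    IsQuasiaccretive (H := D.H0 m) (transportGraph σ) (c * ‖σ‖) := by
  rintro z ⟨ψ, hψ, hz⟩
  have hmul : ‖mulH0 m ψ σ‖ ≤ c * ‖σ‖ * ‖D.toH0 m ψ‖ := hc σ ψ _ (isProduct_mulH0 σ ψ)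
  have hstream := inner_streamingTest_nonneg m ψ
  have hinner := (abs_le.mp (abs_real_inner_le_norm (mulH0 m ψ σ) (D.toH0 m ψ))).1
  have hnorm := mul_le_mul_of_nonneg_right hmul (norm_nonneg (D.toH0 m ψ))
  rw [← hψ, isTransportImage_iff.mp hz, inner_add_left]
  linarith

theorem mem_transportGraph (σ : D.W m) (ψ : D.testSpace) :
    (D.toH0 m ψ, D.toH0 m (streamingTest ψ) + mulH0 m ψ σ) ∈ transportGraph σ :=
  ⟨ψ, rfl, isTransportImage_iff.mpr rfl⟩

theorem graph_transportOp (σ : D.W m) : (transportOp σ).graph = transportGraph σ :=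
  Submodule.toLinearPMap_graph_eq _ fun _ =>
    (isQuasiaccretive_transportGraph (productBound_productConst D m) σ).snd_eq_zero
      (denseRange_toH0.mono (range_subset_iff.mpr fun ψ => ⟨_, mem_transportGraph σ ψ, rfl⟩))

theorem isQuasiaccretive_transportOp {c : ℝ} (hc : D.ProductBound m c) (σ : D.W m) :
    IsQuasiaccretive (transportOp σ).graph (c * ‖σ‖) :=
  graph_transportOp σ ▸ isQuasiaccretive_transportGraph hc σ

theorem exists_isTransportImage_transportOp (σ : D.W m) (ψ : D.testSpace) :
    ∃ h : D.toH0 m ψ ∈ (transportOp σ).domain,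
      IsTransportImage σ ψ (transportOp σ ⟨D.toH0 m ψ, h⟩) := by
  have hgraph : (D.toH0 m ψ, D.toH0 m (streamingTest ψ) + mulH0 m ψ σ) ∈ (transportOp σ).graph :=
    graph_transportOp σ ▸ mem_transportGraph σ ψ
  have hdomain := LinearPMap.mem_domain_of_mem_graph hgraph
  refine ⟨hdomain, isTransportImage_iff.mpr ?_⟩
  exact (transportOp σ).mem_graph_snd_inj ((transportOp σ).mem_graph ⟨_, hdomain⟩) hgraph rfl

theorem dense_domain_transportOp (σ : D.W m) : Dense ((transportOp σ).domain : Set (D.H0 m)) :=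
  denseRange_toH0.mono (range_subset_iff.mpr fun ψ =>
    (exists_isTransportImage_transportOp σ ψ).fst)

end Domain

end Transport

theorem lemma3p1 (m : ℕ) :
    -- a constant for the product estimate exists and depends on `m` only
    (∃ c : ℝ, 0 < c ∧ ∀ D : Transport.Domain, D.ProductBound m c) ∧
    ∀ (D : Transport.Domain) (σ : D.W m),
      -- the products `Σ ψ` and the operator `P_m` are well defined, and `P_m` is closable
      (∀ ψ : D.testSpace, ∃! w : D.H0 m, Transport.Domain.IsProduct σ ψ w) ∧
      (∀ ψ : D.testSpace, ∃ h : D.toH0 m ψ ∈ (Transport.Domain.transportOp σ).domain,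
        Transport.Domain.IsTransportImage σ ψ
          (Transport.Domain.transportOp σ ⟨D.toH0 m ψ, h⟩)) ∧
      (Transport.Domain.transportOp σ).IsClosable ∧
      -- the estimate, for every constant `c` that is admissible in the product estimate
      ∀ c : ℝ, 0 < c → D.ProductBound m c → ∀ C : ℝ, c * ‖σ‖ ≤ C →
        (∀ ψ : (Transport.Domain.transportOp σ).closure.domain,
          (C - c * ‖σ‖) * ‖(ψ : D.H0 m)‖ ^ 2 ≤
            inner ℝ ((Transport.Domain.transportOp σ).closure ψ + C • (ψ : D.H0 m))
              (ψ : D.H0 m)) ∧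
        Transport.IsAccretive
          ((C • (LinearMap.id : D.H0 m →ₗ[ℝ] D.H0 m)) +ᵥ
            (Transport.Domain.transportOp σ).closure) := by
  refine ⟨⟨Transport.productConst m, Transport.productConst_pos m,
    fun D => D.productBound_productConst m⟩, fun D σ => ?_⟩
  have hdense := Transport.Domain.dense_domain_transportOp σ
  refine ⟨fun ψ => ⟨_, Transport.Domain.isProduct_mulH0 σ ψ,
      fun _ => Transport.Domain.isProduct_iff.mp⟩,
    Transport.Domain.exists_isTransportImage_transportOp σ, ?_, fun c _ hc C hC => ?_⟩
  · exact (Transport.Domain.isQuasiaccretive_transportOp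
      (D.productBound_productConst m) σ).isClosable hdense
  · have hclosure := (Transport.Domain.isQuasiaccretive_transportOp hc σ).closure hdense
    exact ⟨hclosure.le_inner_add_smul C, hclosure.isAccretive_smul_id_vadd hC⟩
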